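/- Let $X$ be a smooth manifold, or more generally any paracompact Hausdorff space, let $n\ge 0$, and let $\pi\colon Z\to X$ be a principal bundle for the discrete additive group $\mathfrak{so}(n,\mathbb{Z})$ of skew-symmetric integer $n\times n$ matrices. Write $\mathbb{T}^n=(\mathbb{R}/\mathbb{Z})^n$ and, for indices $p,q$, let $Z^{pq}$ be the principal $\mathbb{Z}$-bundle over $X$ obtained from $Z$ by extending the structure group along the homomorphism $\mathfrak{so}(n,\mathbb{Z})\to\mathbb{Z}$, $B\mapsto B_{pq}$, with class $[Z^{pq}]\in \mathrm{H}^1(X,\mathbb{Z})$. Let $\mathcal{P}=(\mathbb{R}\times\mathbb{R}\times\mathbb{R}/\mathbb{Z})/\!\sim$, with $(a,\hat a,t)\sim(a+k,\hat a+m,k\hat a+t)$ for $k,m\in\mathbb{Z}$, be the Poincaré bundle over $\mathbb{T}^2$, and for $B\in\mathfrak{so}(n,\mathbb{Z})$ put $\mathcal{P}_B=\bigotimes_{1\le j<i\le n}\mathrm{pr}_{ij}^*\mathcal{P}^{\otimes B_{ij}}$, a principal circle bundle over $\mathbb{T}^n$. Let $\mathcal{R}(Z)$ be the following circle bundle gerbe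 over $X\times\mathbb{T}^n$. Its covering map is $Z\times\mathbb{T}^n\to X\times\mathbb{T}^n$. Over $Z^{[2]}\times\mathbb{T}^n$, where $Z^{[2]}=Z\times_X Z$, its circle bundle is $\mathrm{pr}_{\mathbb{T}^n}^*\mathcal{P}_B$, where $B\colon Z^{[2]}\to\mathfrak{so}(n,\mathbb{Z})$ is the locally constant map with $z_2=z_1\cdot B(z_1,z_2)$. Its bundle gerbe product is given by the canonical isomorphisms $\mathcal{P}_{B_{12}}\otimes\mathcal{P}_{B_{23}}\cong\mathcal{P}_{B_{12}+B_{23}}=\mathcal{P}_{B_{13}}$. Then, for any generator $\gamma$ of $\mathrm{H}^1(\mathbb{R}/\mathbb{Z},\mathbb{Z})$, the Dixmier–Douady class of $\mathcal{R}(Z)$ is $$\mathrm{DD}(\mathcal{R}(Z))=\sum_{1\le q<p\le n}\mathrm{pr}_p^*\gamma\cup\mathrm{pr}_q^*\gamma\cup\mathrm{pr}_X^*[Z^{pq}]\;\in\;\mathrm{H}^3(X\times\mathbb{T}^n,\mathbb{Z}),$$ where $\mathrm{pr}_p\colon X\times\mathbb{T}^n\to\mathbb{R}/\mathbb{Z}$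 is the projection to the $p$-th component of $\mathbb{T}^n$ and $\mathrm{pr}_X$ is the projection to $X$. In particular, $\mathrm{DD}(\mathcal{R}(Z))$ lies in the step $F_1\mathrm{H}^3(X\times\mathbb{T}^n,\mathbb{Z})$ of the filtration in which $F_i\mathrm{H}^k(E,\mathbb{Z})$, for a continuous map $E\to X$, consists of the classes whose pullback along $f^*E\to E$ vanishes for every continuous map $f\colon C\to X$ defined on a CW complex $C$ of dimension at most $i-1$. Here $\mathrm{H}^k(-,\mathbb{Z})$ is Čech cohomology with the standard coboundary $\delta$. The class of a principal bundle is represented by the transition cocycle $z_{xy}$ of local sections $\sigma_x$, with $\sigma_y=\sigma_x\cdot z_{xy}$. The Dixmier–Douady class of a bundle gerbe with product $\mu$, local sections $\sigma_x$ of its covering map and sections $s_{xy}$ of its circle bundle along $(\sigma_x,\sigma_y)$ is represented by $\delta\eta$, where the real-valued functions $\eta_{xyz}$ satisfy $\mu(s_{xy}\otimes s_{yz})=s_{xz}\cdot\eta_{xyz}$ modulo $\mathbb{Z}$. -/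

import Mathlib

open Topology Set

noncomputable section

set_option linter.unusedSectionVars false

/-! ## Čech cohomology -/

namespace Cech

/-- A `k`-cochain assigns to a `(k+1)`-tuple `x` of indices a function; only the values of `c x` on
the overlap of the members of a cover that are indexed by `x` will matter. Covers are indexed by the
points of the space. -/
abbrev RawCochain (A : Type*) (M : Type*) (k : ℕ) : Type _ := (Fin (k + 1) → M) → M → A

/-- An open cover of `M`, indexed by the points of `M`, with `x` in the member with index `x`.
Every open cover is refined by such a cover; refinement is inclusion for each index. -/
structure PointedCover (M : Type*) [TopologicalSpace M] where
  set : M → Set M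
  isOpen_set : ∀ x, IsOpen (set x)
  mem_set : ∀ x, x ∈ set x

namespace PointedCover

variable {M N : Type*} [TopologicalSpace M] [TopologicalSpace N]

/-- The overlap `U_{x 0} ∩ ⋯ ∩ U_{x k}`. -/
def overlap (U : PointedCover M) {k : ℕ} (x : Fin (k + 1) → M) : Set M := {u | ∀ i, u ∈ U.set (x i)}

/-- The common refinement of two covers. -/
def inf (U V : PointedCover M) : PointedCover M where
  set x := U.set x ∩ V.set x
  isOpen_set x := (U.isOpen_set x).inter (V.isOpen_set x)
  mem_set x := ⟨U.mem_set x, V.mem_set x⟩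

/-- The cover with only member `M`. -/
def top : PointedCover M := ⟨fun _ ↦ univ, fun _ ↦ isOpen_univ, fun _ ↦ mem_univ _⟩

/-- The preimage of a cover. -/
def comap (f : C(N, M)) (U : PointedCover M) : PointedCover N where
  set y := f ⁻¹' U.set (f y)
  isOpen_set _ := (U.isOpen_set _).preimage f.continuous
  mem_set _ := U.mem_set _

lemma overlap_inf (U V : PointedCover M) {k : ℕ} (x : Fin (k + 1) → M) :
    (U.inf V).overlap x = U.overlap x ∩ V.overlap x := by
  ext u; simp [overlap, inf, forall_and]

lemma overlap_subset (U : PointedCover M) {k l : ℕ} (x : Fin (k + 1) → M)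
    (s : Fin (l + 1) → Fin (k + 1)) : U.overlap x ⊆ U.overlap (x ∘ s) :=
  fun _ hu i ↦ hu (s i)

end PointedCover

/-- The Čech differential, `(dc)(x₀, …, x_{k+1}) = ∑ᵢ (-1)ⁱ c(x₀, …, x̂ᵢ, …, x_{k+1})`. -/
def d {A M : Type*} [AddCommGroup A] (k : ℕ) : RawCochain A M k →+ RawCochain A M (k + 1) where
  toFun c x u := ∑ i : Fin (k + 2), (-1 : ℤ) ^ (i : ℕ) • c (x ∘ i.succAbove) u
  map_zero' := by ext; simp
  map_add' a b := by ext; simp [Finset.sum_add_distrib]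

section Groups

variable (A : Type*) [AddCommGroup A] [TopologicalSpace A] [IsTopologicalAddGroup A]
variable (M : Type*) [TopologicalSpace M] (k : ℕ)

/-- The cochains with respect to some open cover, with values in the sheaf of continuous `A`-valued
functions (the locally constant functions if `A` is discrete). -/
def cochains : AddSubgroup (RawCochain A M k) where
  carrier := {c | ∃ U : PointedCover M, ∀ x, ContinuousOn (c x) (U.overlap x)}
  zero_mem' := ⟨.top, fun _ ↦ continuousOn_const⟩
  add_mem' := by
    rintro a b ⟨U, hU⟩ ⟨V, hV⟩
    refine ⟨U.inf V, fun x ↦ ?_⟩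
    rw [PointedCover.overlap_inf]
    exact ((hU x).mono inter_subset_left).add ((hV x).mono inter_subset_right)
  neg_mem' := by
    rintro a ⟨U, hU⟩
    exact ⟨U, fun x ↦ (hU x).neg⟩

/-- The cochains that vanish on all overlaps of some open cover. The quotient of `cochains` by this
subgroup is the colimit, over all open covers, of the groups of Čech cochains. -/
def nullCochains : AddSubgroup (RawCochain A M k) where
  carrier := {c | ∃ U : PointedCover M, ∀ x, ∀ u ∈ U.overlap x, c x u = 0}
  zero_mem' := ⟨.top, fun _ _ _ ↦ rfl⟩
  add_mem' := by
    rintro a b ⟨U, hU⟩ ⟨V, hV⟩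
    refine ⟨U.inf V, fun x u hu ↦ ?_⟩
    rw [PointedCover.overlap_inf] at hu
    simp [hU x u hu.1, hV x u hu.2]
  neg_mem' := by
    rintro a ⟨U, hU⟩
    exact ⟨U, fun x u hu ↦ by simp [hU x u hu]⟩

/-- The cochains whose differential vanishes on all overlaps of some open cover. -/
def cocycles : AddSubgroup (RawCochain A M k) :=
  cochains A M k ⊓ (nullCochains A M (k + 1)).comap (d k)

/-- The cochains that agree with a coboundary on all overlaps of some open cover. -/
def coboundaries : (k : ℕ) → AddSubgroup (RawCochain A M k)
  | 0 => nullCochains A M 0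
  | k + 1 => nullCochains A M (k + 1) ⊔ (cochains A M k).map (d k)

end Groups

/-- Čech cohomology `Ȟᵏ(M, A)` (the colimit over all open covers) with values in the sheaf of
continuous `A`-valued functions; for discrete `A` this is cohomology with coefficients in `A`. -/
abbrev H (A : Type*) [AddCommGroup A] [TopologicalSpace A] [IsTopologicalAddGroup A]
    (M : Type*) [TopologicalSpace M] (k : ℕ) : Type _ :=
  cocycles A M k ⧸ (coboundaries A M k).addSubgroupOf (cocycles A M k)

section Lemmas

variable {A : Type*} [AddCommGroup A] [TopologicalSpace A] [IsTopologicalAddGroup A]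
variable {M N : Type*} [TopologicalSpace M] [TopologicalSpace N] {k : ℕ}

lemma nullCochains_le_coboundaries : nullCochains A M k ≤ coboundaries A M k := by
  cases k with
  | zero => exact le_rfl
  | succ k => exact le_sup_left

/-- The cohomology class of a cocycle. -/
def H.mk (c : RawCochain A M k) (hc : c ∈ cocycles A M k) : H A M k :=
  QuotientAddGroup.mk ⟨c, hc⟩

/-- The pullback of cochains along a map. -/
def rawPullback (A : Type*) [AddCommGroup A] {M N : Type*} (f : N → M) (k : ℕ) :
    RawCochain A M k →+ RawCochain A N k where
  toFun c y v := c (f ∘ y) (f v)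
  map_zero' := rfl
  map_add' _ _ := rfl

lemma d_rawPullback (f : N → M) (c : RawCochain A M k) :
    d k (rawPullback A f k c) = rawPullback A f (k + 1) (d k c) := rfl

lemma rawPullback_mem_cochains (f : C(N, M)) {c : RawCochain A M k} (hc : c ∈ cochains A M k) :
    rawPullback A f k c ∈ cochains A N k := by
  obtain ⟨U, hU⟩ := hc
  exact ⟨U.comap f, fun y ↦ (hU (f ∘ y)).comp f.continuous.continuousOn fun _ hv i ↦ hv i⟩

lemma rawPullback_mem_nullCochains (f : C(N, M)) {c : RawCochain A M k}
    (hc : c ∈ nullCochains A M k) : rawPullback A f k c ∈ nullCochains A N k := by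
  obtain ⟨U, hU⟩ := hc
  exact ⟨U.comap f, fun y v hv ↦ hU (f ∘ y) (f v) fun i ↦ hv i⟩

lemma rawPullback_mem_cocycles (f : C(N, M)) {c : RawCochain A M k} (hc : c ∈ cocycles A M k) :
    rawPullback A f k c ∈ cocycles A N k :=
  ⟨rawPullback_mem_cochains f hc.1, rawPullback_mem_nullCochains f hc.2⟩

lemma rawPullback_mem_coboundaries (f : C(N, M)) {c : RawCochain A M k}
    (hc : c ∈ coboundaries A M k) : rawPullback A f k c ∈ coboundaries A N k := by
  cases k with
  | zero => exact rawPullback_mem_nullCochains f hc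
  | succ k =>
    obtain ⟨a, ha, _, ⟨b, hb, rfl⟩, rfl⟩ := AddSubgroup.mem_sup.1 hc
    rw [map_add, ← d_rawPullback]
    exact add_mem (AddSubgroup.mem_sup_left (rawPullback_mem_nullCochains f ha))
      (AddSubgroup.mem_sup_right ⟨_, rawPullback_mem_cochains f hb, rfl⟩)

/-- The pullback `f^* : Ȟᵏ(M, A) → Ȟᵏ(N, A)` along a continuous map. -/
def pullback (f : C(N, M)) : H A M k →+ H A N k :=
  QuotientAddGroup.map _ _
    (((rawPullback A f k).comp (cocycles A M k).subtype).codRestrict (cocycles A N k)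
      fun c ↦ rawPullback_mem_cocycles f c.2)
    fun _ hc ↦ rawPullback_mem_coboundaries f hc

end Lemmas

/-! ### Cup product -/

section Cup

variable {R : Type*} [CommRing R] {M : Type*} {k l m : ℕ}

/-- The index tuple `(x₀, …, x_k)`. -/
def front (h : k + l = m) (x : Fin (m + 1) → M) : Fin (k + 1) → M := fun i ↦ x ⟨i, by omega⟩

/-- The index tuple `(x_k, …, x_{k+l})`. -/
def back (h : k + l = m) (x : Fin (m + 1) → M) : Fin (l + 1) → M := fun i ↦ x ⟨k + i, by omega⟩

/-- The cup product `(a ∪ b)(x₀, …, x_{k+l}) = a(x₀, …, x_k) · b(x_k, …, x_{k+l})`. -/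
def rawCup (h : k + l = m) (a : RawCochain R M k) (b : RawCochain R M l) : RawCochain R M m :=
  fun x u ↦ a (front h x) u * b (back h x) u

lemma d_rawCup (h : k + l = m) (h₁ : k + 1 + l = m + 1) (h₂ : k + (l + 1) = m + 1)
    (a : RawCochain R M k) (b : RawCochain R M l) :
    d m (rawCup h a b) = rawCup h₁ (d k a) b + (-1 : ℤ) ^ k • rawCup h₂ a (d l b) := by
  subst h
  ext x u
  have e1 : ∀ i : Fin (k + 1), front rfl (x ∘ Fin.succAbove (⟨i, by omega⟩ : Fin (k + l + 2)))
      = front h₁ x ∘ Fin.succAbove i.castSucc := by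
    intro i; funext j
    simp only [front, Function.comp, Fin.succAbove, Fin.lt_def, Fin.val_castSucc]
    congr 1; split_ifs <;> simp
  have e2 : ∀ i : Fin (k + 1), back (l := l) rfl
      (x ∘ Fin.succAbove (⟨i, by omega⟩ : Fin (k + l + 2))) = back h₁ x := by
    intro i; funext j
    simp only [back, Function.comp, Fin.succAbove, Fin.lt_def, Fin.val_castSucc]
    congr 1
    rw [if_neg (by omega)]; simp [Fin.ext_iff]; omega
  have e3 : ∀ i : Fin (l + 1), front rfl
      (x ∘ Fin.succAbove (⟨k + 1 + i, by omega⟩ : Fin (k + l + 2))) = front h₂ x := by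
    intro i; funext j
    simp only [front, Function.comp, Fin.succAbove, Fin.lt_def, Fin.val_castSucc]
    congr 1
    rw [if_pos (by omega)]; simp
  have e4 : ∀ i : Fin (l + 1), back (l := l) rfl
      (x ∘ Fin.succAbove (⟨k + 1 + i, by omega⟩ : Fin (k + l + 2)))
      = back h₂ x ∘ Fin.succAbove i.succ := by
    intro i; funext j
    simp only [back, Function.comp, Fin.succAbove, Fin.lt_def, Fin.val_castSucc, Fin.val_succ]
    congr 1; split_ifs <;> simp [Fin.ext_iff] <;> omega
  have e5 : front h₁ x ∘ Fin.succAbove (Fin.last (k + 1)) = front h₂ x := by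
    funext j; simp [front]
  have e6 : back h₂ x ∘ Fin.succAbove 0 = back h₁ x := by
    funext j; simp [back]; congr 1; simp [Fin.ext_iff]; omega
  have hs : ∀ f : Fin (k + l + 2) → R, ∑ i, f i
      = ∑ i : Fin (k + 1), f ⟨i, by omega⟩ + ∑ i : Fin (l + 1), f ⟨k + 1 + i, by omega⟩ := by
    intro f
    rw [← Fin.sum_congr' f (show k + 1 + (l + 1) = k + l + 2 by omega), Fin.sum_univ_add]
    rfl
  simp only [d, AddMonoidHom.coe_mk, ZeroHom.coe_mk, rawCup, Pi.add_apply, Pi.smul_apply]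
  rw [hs, Fin.sum_univ_castSucc (n := k + 1), Fin.sum_univ_succ (n := l + 1)]
  simp only [e1, e2, e3, e4, e5, e6, Fin.val_castSucc, Fin.val_last, Fin.val_succ, Fin.val_zero,
    add_mul, mul_add, Finset.sum_mul, Finset.mul_sum, Finset.smul_sum, smul_add, smul_mul_assoc,
    mul_smul_comm, smul_smul, pow_zero, one_smul, pow_add, pow_one, mul_neg, neg_smul,
    mul_one, smul_neg, neg_mul, Finset.sum_neg_distrib]
  abel

variable [TopologicalSpace R] [IsTopologicalRing R] [TopologicalSpace M]

lemma rawCup_mem_cochains (h : k + l = m) {a : RawCochain R M k} {b : RawCochain R M l}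
    (ha : a ∈ cochains R M k) (hb : b ∈ cochains R M l) : rawCup h a b ∈ cochains R M m := by
  obtain ⟨U, hU⟩ := ha
  obtain ⟨V, hV⟩ := hb
  refine ⟨U.inf V, fun x ↦ ?_⟩
  rw [PointedCover.overlap_inf]
  exact ((hU _).mono fun u hu i ↦ hu.1 _).mul ((hV _).mono fun u hu i ↦ hu.2 _)

lemma rawCup_mem_null_left (h : k + l = m) {a : RawCochain R M k} (b : RawCochain R M l)
    (ha : a ∈ nullCochains R M k) : rawCup h a b ∈ nullCochains R M m := by
  obtain ⟨U, hU⟩ := ha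
  exact ⟨U, fun x u hu ↦ by simp [rawCup, hU (front h x) u fun i ↦ hu _]⟩

lemma rawCup_mem_null_right (h : k + l = m) (a : RawCochain R M k) {b : RawCochain R M l}
    (hb : b ∈ nullCochains R M l) : rawCup h a b ∈ nullCochains R M m := by
  obtain ⟨U, hU⟩ := hb
  exact ⟨U, fun x u hu ↦ by simp [rawCup, hU (back h x) u fun i ↦ hu _]⟩

lemma rawCup_mem_cocycles (h : k + l = m) {a : RawCochain R M k} {b : RawCochain R M l}
    (ha : a ∈ cocycles R M k) (hb : b ∈ cocycles R M l) : rawCup h a b ∈ cocycles R M m := by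
  refine ⟨rawCup_mem_cochains h ha.1 hb.1, ?_⟩
  change d m (rawCup h a b) ∈ nullCochains R M (m + 1)
  rw [d_rawCup h (by omega) (by omega)]
  exact add_mem (rawCup_mem_null_left _ _ ha.2) (zsmul_mem (rawCup_mem_null_right _ _ hb.2) _)

lemma rawCup_add_left (h : k + l = m) (a a' : RawCochain R M k) (b : RawCochain R M l) :
    rawCup h (a + a') b = rawCup h a b + rawCup h a' b := by
  ext; simp [rawCup, add_mul]

lemma rawCup_add_right (h : k + l = m) (a : RawCochain R M k) (b b' : RawCochain R M l) :
    rawCup h a (b + b') = rawCup h a b + rawCup h a b' := by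
  ext; simp [rawCup, mul_add]

lemma rawCup_mem_coboundaries_left (h : k + l = m) {a : RawCochain R M k} {b : RawCochain R M l}
    (ha : a ∈ coboundaries R M k) (hb : b ∈ cocycles R M l) :
    rawCup h a b ∈ coboundaries R M m := by
  cases k with
  | zero => exact nullCochains_le_coboundaries (rawCup_mem_null_left h b ha)
  | succ k =>
    obtain ⟨a, ha', _, ⟨c, hc, rfl⟩, rfl⟩ := AddSubgroup.mem_sup.1 ha
    obtain ⟨m, rfl⟩ : ∃ m', m = m' + 1 := ⟨k + l, by omega⟩
    rw [rawCup_add_left]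
    refine add_mem (nullCochains_le_coboundaries (rawCup_mem_null_left h b ha')) ?_
    have := d_rawCup (show k + l = m by omega) h (by omega) c b
    rw [← sub_eq_iff_eq_add] at this
    rw [← this]
    exact sub_mem (AddSubgroup.mem_sup_right ⟨_, rawCup_mem_cochains _ hc hb.1, rfl⟩)
      (nullCochains_le_coboundaries (zsmul_mem (rawCup_mem_null_right _ _ hb.2) _))

lemma rawCup_mem_coboundaries_right (h : k + l = m) {a : RawCochain R M k} {b : RawCochain R M l}
    (ha : a ∈ cocycles R M k) (hb : b ∈ coboundaries R M l) :
    rawCup h a b ∈ coboundaries R M m := by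
  cases l with
  | zero => exact nullCochains_le_coboundaries (rawCup_mem_null_right h a hb)
  | succ l =>
    obtain ⟨b, hb', _, ⟨c, hc, rfl⟩, rfl⟩ := AddSubgroup.mem_sup.1 hb
    obtain ⟨m, rfl⟩ : ∃ m', m = m' + 1 := ⟨k + l, by omega⟩
    rw [rawCup_add_right]
    refine add_mem (nullCochains_le_coboundaries (rawCup_mem_null_right h a hb')) ?_
    have := d_rawCup (show k + l = m by omega) (by omega) h a c
    rw [← sub_eq_iff_eq_add'] at this
    have h2 : rawCup h a (d l c) = (-1 : ℤ) ^ k • ((-1 : ℤ) ^ k • rawCup h a (d l c)) := by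
      rw [smul_smul, ← mul_pow]; simp
    rw [h2, ← this]
    exact zsmul_mem (sub_mem (AddSubgroup.mem_sup_right
      (AddSubgroup.mem_map_of_mem _ (rawCup_mem_cochains _ ha.1 hc)))
      (nullCochains_le_coboundaries (rawCup_mem_null_left _ _ ha.2))) _

/-- The cup product `∪ : Ȟᵏ(M, R) × Ȟˡ(M, R) → Ȟᵏ⁺ˡ(M, R)`. -/
def cup : H R M k →+ H R M l →+ H R M (k + l) :=
  QuotientAddGroup.lift _
    (AddMonoidHom.mk' (fun a ↦ QuotientAddGroup.lift _
      (AddMonoidHom.mk' (fun b ↦ H.mk (rawCup rfl a.1 b.1) (rawCup_mem_cocycles rfl a.2 b.2))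
        fun b b' ↦ congrArg QuotientAddGroup.mk (Subtype.ext (rawCup_add_right rfl a.1 b.1 b'.1)))
      fun b hb ↦ (QuotientAddGroup.eq_zero_iff _).2 (rawCup_mem_coboundaries_right rfl a.2 hb))
      fun a a' ↦ by
        ext b
        exact congrArg QuotientAddGroup.mk (Subtype.ext (rawCup_add_left rfl a.1 a'.1 b.1)))
    fun a ha ↦ by
      ext b
      exact (QuotientAddGroup.eq_zero_iff _).2 (rawCup_mem_coboundaries_left rfl ha b.2)

end Cup

end Cech

/-! ## Principal bundles -/

namespace TorusGerbe

/-- `π : E → B` is a (locally trivial) principal bundle for the abelian topological group `G`. -/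
structure IsPrincipalBundle (G : Type*) [AddCommGroup G] [TopologicalSpace G]
    {E B : Type*} [TopologicalSpace E] [TopologicalSpace B] [AddAction G E] (π : E → B) : Prop where
  proj_vadd : ∀ (g : G) (e : E), π (g +ᵥ e) = π e
  exists_trivialization : ∀ b : B, ∃ τ : Bundle.Trivialization G π, b ∈ τ.baseSet ∧
    ∀ (g : G) (e : E), π e ∈ τ.baseSet → (τ (g +ᵥ e)).2 = g + (τ e).2

lemma exists_trivialization_of {G E B : Type*} [TopologicalSpace G] [TopologicalSpace E]
    [TopologicalSpace B] {π : E → B} (hπ : Continuous π) {S : Set B} (hS : IsOpen S)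
    (f : E → G) (s : B × G → E) (hf : ContinuousOn f (π ⁻¹' S)) (hs : ContinuousOn s (S ×ˢ univ))
    (h1 : ∀ b ∈ S, ∀ g, π (s (b, g)) = b) (h2 : ∀ b ∈ S, ∀ g, f (s (b, g)) = g)
    (h3 : ∀ e, π e ∈ S → s (π e, f e) = e) :
    ∃ τ : Bundle.Trivialization G π, τ.baseSet = S ∧ ∀ e, (τ e).2 = f e :=
  ⟨{ toFun := fun e ↦ (π e, f e)
     invFun := s
     source := π ⁻¹' S
     target := S ×ˢ univ
     map_source' := fun e he ↦ ⟨he, mem_univ _⟩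
     map_target' := fun p hp ↦ by
       change π (s (p.1, p.2)) ∈ S
       rw [h1 p.1 hp.1]; exact hp.1
     left_inv' := fun e he ↦ h3 e he
     right_inv' := fun p hp ↦ Prod.ext (h1 p.1 hp.1 p.2) (h2 p.1 hp.1 p.2)
     open_source := hS.preimage hπ
     open_target := hS.prod isOpen_univ
     continuousOn_toFun := hπ.continuousOn.prodMk hf
     continuousOn_invFun := hs
     baseSet := S
     open_baseSet := hS
     source_eq := rfl
     target_eq := rfl
     proj_toFun := fun _ _ ↦ rfl }, rfl, fun _ ↦ rfl⟩

section Trivialization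

variable {G E B : Type*} [TopologicalSpace G] [TopologicalSpace E] [TopologicalSpace B] {π : E → B}
  (τ : Bundle.Trivialization G π)

lemma continuousOn_triv_snd : ContinuousOn (fun e ↦ (τ e).2) (π ⁻¹' τ.baseSet) := by
  rw [← τ.source_eq]
  exact continuous_snd.comp_continuousOn τ.continuousOn_toFun

lemma continuousOn_triv_symm :
    ContinuousOn (fun p ↦ τ.toOpenPartialHomeomorph.symm p) (τ.baseSet ×ˢ (univ : Set G)) := by
  rw [← τ.target_eq]
  exact τ.continuousOn_invFun

lemma triv_ext {e e' : E} (he : π e ∈ τ.baseSet) (h : π e = π e') (h' : (τ e).2 = (τ e').2) :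
    e = e' := by
  have he' : π e' ∈ τ.baseSet := h ▸ he
  refine τ.injOn (τ.mem_source.2 he) (τ.mem_source.2 he') (Prod.ext ?_ h')
  change (τ e).1 = (τ e').1
  rw [τ.coe_fst' he, τ.coe_fst' he', h]

lemma triv_symm_snd {e : E} (he : π e ∈ τ.baseSet) :
    τ.toOpenPartialHomeomorph.symm (π e, (τ e).2) = e := by
  have hp : π (τ.toOpenPartialHomeomorph.symm (π e, (τ e).2)) = π e := τ.proj_symm_apply' he
  exact triv_ext τ (hp.symm ▸ he) hp (by rw [τ.apply_symm_apply' he])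

end Trivialization

namespace IsPrincipalBundle

variable {G : Type*} [AddCommGroup G] [TopologicalSpace G] [IsTopologicalAddGroup G]
  {E B : Type*} [TopologicalSpace E] [TopologicalSpace B] [AddAction G E] {π : E → B}

lemma continuous_proj (h : IsPrincipalBundle G π) : Continuous π := by
  refine continuous_iff_continuousAt.2 fun e ↦ ?_
  obtain ⟨τ, hb, -⟩ := h.exists_trivialization (π e)
  exact τ.continuousAt_proj (τ.mem_source.2 hb)

lemma surjective (h : IsPrincipalBundle G π) : Function.Surjective π := fun b ↦ by
  obtain ⟨τ, hb, -⟩ := h.exists_trivialization b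
  exact ⟨τ.toOpenPartialHomeomorph.symm (b, 0), τ.proj_symm_apply' hb⟩

lemma exists_vadd_eq (h : IsPrincipalBundle G π) {e e' : E} (hee' : π e = π e') :
    ∃ g : G, g +ᵥ e = e' := by
  obtain ⟨τ, hb, hτ⟩ := h.exists_trivialization (π e)
  refine ⟨(τ e').2 - (τ e).2, triv_ext τ ?_ ?_ ?_⟩
  · rw [h.proj_vadd]; exact hb
  · rw [h.proj_vadd, hee']
  · rw [hτ _ _ hb, sub_add_cancel]

lemma vadd_right_cancel (h : IsPrincipalBundle G π) {g g' : G} {e : E} (hg : g +ᵥ e = g' +ᵥ e) :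
    g = g' := by
  obtain ⟨τ, hb, hτ⟩ := h.exists_trivialization (π e)
  have := hτ g e hb
  rw [hg, hτ g' e hb] at this
  exact (add_right_cancel this).symm

lemma continuous_vadd (h : IsPrincipalBundle G π) : Continuous fun p : G × E ↦ p.1 +ᵥ p.2 := by
  refine continuous_iff_continuousAt.2 fun ⟨g, e⟩ ↦ ?_
  obtain ⟨τ, hb, hτ⟩ := h.exists_trivialization (π e)
  have hS : {p : G × E | π p.2 ∈ τ.baseSet} ∈ 𝓝 (g, e) :=
    (τ.open_baseSet.preimage (h.continuous_proj.comp continuous_snd)).mem_nhds hb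
  have hc : ContinuousOn (fun p : G × E ↦ τ.toOpenPartialHomeomorph.symm (π p.2, p.1 + (τ p.2).2))
      {p : G × E | π p.2 ∈ τ.baseSet} := by
    refine (continuousOn_triv_symm τ).comp ?_ fun p hp ↦ ⟨hp, mem_univ _⟩
    refine (h.continuous_proj.comp continuous_snd).continuousOn.prodMk
      (continuous_fst.continuousOn.add ?_)
    exact (continuousOn_triv_snd τ).comp continuous_snd.continuousOn fun p hp ↦ hp
  refine (hc.continuousAt hS).congr ?_
  filter_upwards [hS] with p hp
  have hp' : π (p.1 +ᵥ p.2) ∈ τ.baseSet := by rw [h.proj_vadd]; exact hp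
  conv_rhs => rw [← triv_symm_snd τ hp', h.proj_vadd, hτ _ _ hp]

/-- The difference of two points in the same fibre: `diff e e' +ᵥ e = e'`. -/
def diff (h : IsPrincipalBundle G π) (e e' : E) (hee' : π e = π e') : G :=
  (h.exists_vadd_eq hee').choose

lemma diff_vadd (h : IsPrincipalBundle G π) (e e' : E) (hee' : π e = π e') :
    h.diff e e' hee' +ᵥ e = e' :=
  (h.exists_vadd_eq hee').choose_spec

lemma diff_eq (h : IsPrincipalBundle G π) {e e' : E} (hee' : π e = π e') {g : G}
    (hg : g +ᵥ e = e') : h.diff e e' hee' = g :=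
  h.vadd_right_cancel ((h.diff_vadd e e' hee').trans hg.symm)

lemma diff_add_diff (h : IsPrincipalBundle G π) (e e' e'' : E) (h₁ : π e = π e') (h₂ : π e' = π e'')
    (h₃ : π e = π e'') : h.diff e e' h₁ + h.diff e' e'' h₂ = h.diff e e'' h₃ :=
  (h.diff_eq _ (by rw [add_comm, add_vadd, diff_vadd, diff_vadd])).symm

lemma diff_vadd_vadd (h : IsPrincipalBundle G π) (e e' : E) (g g' : G) (hee' : π e = π e')
    (h₁ : π (g +ᵥ e) = π (g' +ᵥ e')) :
    h.diff (g +ᵥ e) (g' +ᵥ e') h₁ = g' + h.diff e e' hee' - g :=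
  h.diff_eq _ (by rw [vadd_vadd, sub_add_cancel, add_vadd, diff_vadd])

lemma continuous_diff (h : IsPrincipalBundle G π) :
    Continuous fun p : {p : E × E // π p.1 = π p.2} ↦ h.diff p.1.1 p.1.2 p.2 := by
  refine continuous_iff_continuousAt.2 fun ⟨⟨e, e'⟩, hee'⟩ ↦ ?_
  obtain ⟨τ, hb, hτ⟩ := h.exists_trivialization (π e)
  have c1 : Continuous fun p : {p : E × E // π p.1 = π p.2} ↦ p.1.1 := by fun_prop
  have c2 : Continuous fun p : {p : E × E // π p.1 = π p.2} ↦ p.1.2 := by fun_prop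
  have hS : {p : {p : E × E // π p.1 = π p.2} | π p.1.1 ∈ τ.baseSet} ∈ 𝓝 ⟨(e, e'), hee'⟩ :=
    (τ.open_baseSet.preimage (h.continuous_proj.comp c1)).mem_nhds hb
  have hc : ContinuousOn (fun p : {p : E × E // π p.1 = π p.2} ↦ (τ p.1.2).2 - (τ p.1.1).2)
      {p | π p.1.1 ∈ τ.baseSet} := by
    refine ContinuousOn.sub ?_ ?_
    · refine (continuousOn_triv_snd τ).comp c2.continuousOn fun p hp ↦ ?_
      rw [mem_preimage, ← p.2]; exact hp
    · exact (continuousOn_triv_snd τ).comp c1.continuousOn fun p hp ↦ hp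
  refine (hc.continuousAt hS).congr ?_
  filter_upwards [hS] with p hp
  have h1 := hτ (h.diff p.1.1 p.1.2 p.2) p.1.1 hp
  rw [h.diff_vadd] at h1
  rw [h1, add_sub_cancel_right]

/-! ### The class of a principal bundle -/

/-- A chosen local trivialization around `b`. -/
def triv (h : IsPrincipalBundle G π) (b : B) : Bundle.Trivialization G π :=
  (h.exists_trivialization b).choose

lemma mem_triv (h : IsPrincipalBundle G π) (b : B) : b ∈ (h.triv b).baseSet :=
  (h.exists_trivialization b).choose_spec.1

lemma triv_vadd (h : IsPrincipalBundle G π) (b : B) (g : G) (e : E)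
    (he : π e ∈ (h.triv b).baseSet) : (h.triv b (g +ᵥ e)).2 = g + (h.triv b e).2 :=
  (h.exists_trivialization b).choose_spec.2 g e he

/-- The local section of a principal bundle, near `b`, that corresponds to the zero section. -/
def localSection (h : IsPrincipalBundle G π) (b : B) (u : B) : E :=
  (h.triv b).toOpenPartialHomeomorph.symm (u, 0)

/-- The transition cocycle `z` of the local sections `σ`, with `σ_{y} = z_{xy} + σ_{x}`. -/
def transition (h : IsPrincipalBundle G π) : Cech.RawCochain G B 1 :=
  fun x u ↦ (h.triv (x 0) (h.localSection (x 1) u)).2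

/-- The cover by the domains of the chosen trivializations. -/
def cover (h : IsPrincipalBundle G π) : Cech.PointedCover B where
  set b := (h.triv b).baseSet
  isOpen_set b := (h.triv b).open_baseSet
  mem_set b := h.mem_triv b

lemma proj_localSection (h : IsPrincipalBundle G π) {b u : B} (hu : u ∈ h.cover.set b) :
    π (h.localSection b u) = u :=
  (h.triv b).proj_symm_apply' hu

lemma transition_vadd (h : IsPrincipalBundle G π) (x : Fin 2 → B) {u : B}
    (h0 : u ∈ h.cover.set (x 0)) (h1 : u ∈ h.cover.set (x 1)) :
    h.transition x u +ᵥ h.localSection (x 0) u = h.localSection (x 1) u := by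
  have e0 := h.proj_localSection h0
  have e1 := h.proj_localSection h1
  have e0' : π (h.localSection (x 0) u) ∈ (h.triv (x 0)).baseSet := by rw [e0]; exact h0
  have hz : (h.triv (x 0) (h.localSection (x 0) u)).2 = 0 := by
    rw [localSection, (h.triv (x 0)).apply_symm_apply' h0]
  obtain ⟨g, hg⟩ := h.exists_vadd_eq (e0.trans e1.symm)
  rw [transition, ← hg, h.triv_vadd _ _ _ e0', hz, add_zero]

lemma transition_mem_cocycles (h : IsPrincipalBundle G π) :
    h.transition ∈ Cech.cocycles G B 1 := by
  refine ⟨⟨h.cover, fun x ↦ ?_⟩, ⟨h.cover, fun x u hu ↦ ?_⟩⟩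
  · refine (continuousOn_triv_snd (h.triv (x 0))).comp ?_ fun u hu ↦ ?_
    · exact (continuousOn_triv_symm (h.triv (x 1))).comp (Continuous.continuousOn (by fun_prop))
        fun u hu ↦ ⟨hu 1, mem_univ _⟩
    · rw [mem_preimage, h.proj_localSection (hu 1)]
      exact hu 0
  · have h01 := h.transition_vadd ![x 0, x 1] (hu 0) (hu 1)
    have h12 := h.transition_vadd ![x 1, x 2] (hu 1) (hu 2)
    have h02 := h.transition_vadd ![x 0, x 2] (hu 0) (hu 2)
    simp only [Matrix.cons_val_zero, Matrix.cons_val_one] at h01 h12 h02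
    rw [← h12, ← h01, vadd_vadd] at h02
    have := h.vadd_right_cancel h02
    have f0 : x ∘ Fin.succAbove 0 = ![x 1, x 2] := by
      funext i; fin_cases i <;> rfl
    have f1 : x ∘ Fin.succAbove 1 = ![x 0, x 2] := by
      funext i; fin_cases i <;> rfl
    have f2 : x ∘ Fin.succAbove 2 = ![x 0, x 1] := by
      funext i; fin_cases i <;> rfl
    simp only [Cech.d, AddMonoidHom.coe_mk, ZeroHom.coe_mk]
    rw [Fin.sum_univ_three, f0, f1, f2, this]
    simp

/-- The class `[E] ∈ Ȟ¹(B, G)` of a principal `G`-bundle. -/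
def cls (h : IsPrincipalBundle G π) : Cech.H G B 1 :=
  Cech.H.mk h.transition h.transition_mem_cocycles

end IsPrincipalBundle

/-! ### Extension of the structure group -/

section Extension

variable {G : Type*} [AddCommGroup G] [TopologicalSpace G] [IsTopologicalAddGroup G]
  {G' : Type*} [AddCommGroup G'] [TopologicalSpace G'] [IsTopologicalAddGroup G']
  {E B : Type*} [TopologicalSpace E] [TopologicalSpace B] [AddAction G E] {π : E → B}

/-- The relation `(g + e, t) ∼ (e, φ(g) + t)` on `E × G'`, where the homomorphism `φ : G → G'` is
allowed to depend on the base point. -/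
def extensionSetoid (h : IsPrincipalBundle G π) (φ : B → G →+ G') : Setoid (E × G') where
  r p q := ∃ g : G, q.1 = g +ᵥ p.1 ∧ p.2 = φ (π p.1) g + q.2
  iseqv :=
    { refl := fun p ↦ ⟨0, by simp⟩
      symm := by
        rintro p q ⟨g, h1, h2⟩
        exact ⟨-g, by simp [h1], by simp [h1, h2, h.proj_vadd]⟩
      trans := by
        rintro p q r ⟨g, h1, h2⟩ ⟨g', h3, h4⟩
        refine ⟨g' + g, by rw [h3, h1, vadd_vadd], ?_⟩
        rw [h2, h4, h1, h.proj_vadd, map_add]; abel }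

/-- The extension `φ_*(E) = E ×_G G'` of a principal `G`-bundle along a (parameter-dependent)
homomorphism `φ : G → G'`. -/
def Extension (h : IsPrincipalBundle G π) (φ : B → G →+ G') : Type _ :=
  Quotient (extensionSetoid h φ)

namespace Extension

variable (h : IsPrincipalBundle G π) (φ : B → G →+ G')

instance : TopologicalSpace (Extension h φ) :=
  inferInstanceAs (TopologicalSpace (Quotient (extensionSetoid h φ)))

/-- The class of `(e, t)` in `E ×_G G'`. -/
def mk (e : E) (t : G') : Extension h φ := Quotient.mk (extensionSetoid h φ) (e, t)

lemma mk_vadd (g : G) (e : E) (t : G') : mk h φ (g +ᵥ e) t = mk h φ e (φ (π e) g + t) :=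
  Quotient.sound ((extensionSetoid h φ).symm ⟨g, rfl, rfl⟩)

/-- The projection of the extended bundle. -/
def proj : Extension h φ → B :=
  Quotient.lift (fun p : E × G' ↦ π p.1) fun _ _ ⟨_, h1, _⟩ ↦ (h1 ▸ h.proj_vadd _ _).symm

instance : AddAction G' (Extension h φ) where
  vadd s := Quotient.map (fun p : E × G' ↦ (p.1, s + p.2)) fun _ _ ⟨g, h1, h2⟩ ↦
    ⟨g, h1, by simp only [h2]; abel⟩
  zero_vadd := by rintro ⟨e, t⟩; exact congrArg (mk h φ e) (zero_add t)
  add_vadd := by rintro s s' ⟨e, t⟩; exact congrArg (mk h φ e) (add_assoc s s' t)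

@[simp] lemma proj_mk (e : E) (t : G') : proj h φ (mk h φ e t) = π e := rfl

lemma vadd_mk (s : G') (e : E) (t : G') : s +ᵥ mk h φ e t = mk h φ e (s + t) := rfl

lemma exists_mk (q : Extension h φ) : ∃ e t, mk h φ e t = q := by
  obtain ⟨⟨e, t⟩⟩ := q; exact ⟨e, t, rfl⟩

variable {φ}

lemma isOpenQuotientMap_mk (hφ : ∀ g, Continuous fun b ↦ φ b g) :
    IsOpenQuotientMap fun p : E × G' ↦ mk h φ p.1 p.2 where
  surjective := Quotient.mk_surjective
  continuous := continuous_quotient_mk'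
  isOpenMap := fun V hV ↦ by
    have hq : IsQuotientMap (fun p : E × G' ↦ mk h φ p.1 p.2) := isQuotientMap_quotient_mk'
    rw [← hq.isOpen_preimage]
    have : (fun p : E × G' ↦ mk h φ p.1 p.2) ⁻¹' ((fun p : E × G' ↦ mk h φ p.1 p.2) '' V)
        = ⋃ g : G, (fun p : E × G' ↦ (g +ᵥ p.1, p.2 - φ (π p.1) g)) ⁻¹' V := by
      ext p
      simp only [mem_preimage, mem_image, mem_iUnion]
      constructor
      · rintro ⟨q, hq, hqp⟩
        obtain ⟨g, h1, h2⟩ := Quotient.exact hqp.symm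
        exact ⟨g, by rw [h2, add_sub_cancel_left, ← h1]; exact hq⟩
      · rintro ⟨g, hg⟩
        exact ⟨_, hg, by rw [mk_vadd]; simp⟩
    rw [this]
    refine isOpen_iUnion fun g ↦ hV.preimage ?_
    exact (h.continuous_vadd.comp (continuous_const.prodMk continuous_fst)).prodMk
      (continuous_snd.sub ((hφ g).comp (h.continuous_proj.comp continuous_fst)))

lemma continuous_proj : Continuous (proj h φ) :=
  (h.continuous_proj.comp continuous_fst).quotient_lift _

/-- The extended bundle is a principal `G'`-bundle. -/
lemma isPrincipalBundle (hφ : Continuous fun p : B × G ↦ φ p.1 p.2) :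
    IsPrincipalBundle G' (proj h φ) where
  proj_vadd := by rintro s ⟨e, t⟩; rfl
  exists_trivialization b := by
    obtain ⟨τ, hb, hτ⟩ := h.exists_trivialization b
    classical
    let f₀ : E × G' → G' := fun p ↦ if π p.1 ∈ τ.baseSet then φ (π p.1) (τ p.1).2 + p.2 else 0
    have hf₀ : ∀ p q, (extensionSetoid h φ).r p q → f₀ p = f₀ q := by
      rintro p q ⟨g, h1, h2⟩
      simp only [f₀, h1, h.proj_vadd]
      split_ifs with hp
      · rw [hτ _ _ hp, h2, map_add]; abel
      · rfl
    let f : Extension h φ → G' := Quotient.lift f₀ hf₀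
    have hmk : IsQuotientMap fun p : E × G' ↦ mk h φ p.1 p.2 := isQuotientMap_quotient_mk'
    have hf : ∀ e t, π e ∈ τ.baseSet → f (mk h φ e t) = φ (π e) (τ e).2 + t :=
      fun e t he ↦ if_pos he
    obtain ⟨τ', hτ', hτ'f⟩ := exists_trivialization_of (continuous_proj h) τ.open_baseSet f
      (fun p ↦ mk h φ (τ.toOpenPartialHomeomorph.symm (p.1, 0)) p.2)
      (by
        refine (hmk.continuousOn_isOpen_iff (τ.open_baseSet.preimage (continuous_proj h))).2 ?_
        have : ContinuousOn (fun p : E × G' ↦ φ (π p.1) (τ p.1).2 + p.2)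
            {p | π p.1 ∈ τ.baseSet} := by
          refine ContinuousOn.add (hφ.comp_continuousOn (ContinuousOn.prodMk ?_ ?_))
            continuous_snd.continuousOn
          · exact (h.continuous_proj.comp continuous_fst).continuousOn
          · exact (continuousOn_triv_snd τ).comp continuous_fst.continuousOn fun p hp ↦ hp
        exact this.congr fun p hp ↦ hf p.1 p.2 hp)
      (by
        refine hmk.continuous.comp_continuousOn (ContinuousOn.prodMk ?_ continuous_snd.continuousOn)
        exact (continuousOn_triv_symm τ).comp
          (Continuous.continuousOn (f := fun p : B × G' ↦ (p.1, (0 : G))) (by fun_prop))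
          fun p hp ↦ ⟨hp.1, mem_univ _⟩)
      (fun b hb g ↦ τ.proj_symm_apply' hb)
      (fun b hb g ↦ by
        rw [hf _ _ (by rw [τ.proj_symm_apply' hb]; exact hb), τ.apply_symm_apply' hb]
        simp)
      (fun q hq ↦ by
        obtain ⟨e, t, rfl⟩ := exists_mk h φ q
        have hq' : π e ∈ τ.baseSet := hq
        have he : (τ e).2 +ᵥ τ.toOpenPartialHomeomorph.symm (π e, 0) = e := by
          have hp : π (τ.toOpenPartialHomeomorph.symm (π e, 0)) = π e := τ.proj_symm_apply' hq'
          obtain ⟨g, hg⟩ := h.exists_vadd_eq hp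
          have h2 := hτ g _ (hp.symm ▸ hq')
          rw [hg, τ.apply_symm_apply' hq', add_zero] at h2
          rw [h2, hg]
        have hp : π (τ.toOpenPartialHomeomorph.symm (π e, 0)) = π e := τ.proj_symm_apply' hq'
        rw [hf _ _ hq', proj_mk]
        conv_rhs => rw [← he, mk_vadd, hp])
    refine ⟨τ', hτ' ▸ hb, ?_⟩
    intro s q he
    obtain ⟨e, t, rfl⟩ := exists_mk h φ q
    rw [hτ'] at he
    rw [hτ'f, hτ'f]
    change f (mk h φ e (s + t)) = s + f (mk h φ e t)
    rw [hf _ _ he, hf _ _ he]; abel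

end Extension

end Extension

/-! ### Fibre products of pullbacks -/

section FibreProduct

variable {K : Type*} {G : Type*} [AddCommGroup G] [TopologicalSpace G] [IsTopologicalAddGroup G]
  {E B : Type*} [TopologicalSpace E] [TopologicalSpace B] [AddAction G E]
  {W : Type*} [TopologicalSpace W] {π : E → B}

/-- The fibre product over `W` of the pullbacks of `π : E → B` along the maps `f k : W → B`. -/
def FibreProduct (_ : IsPrincipalBundle G π) (f : K → W → B) : Type _ :=
  {p : W × (K → E) // ∀ k, π (p.2 k) = f k p.1}

namespace FibreProduct

variable (h : IsPrincipalBundle G π) (f : K → W → B)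

instance : TopologicalSpace (FibreProduct h f) :=
  inferInstanceAs (TopologicalSpace {p : W × (K → E) // ∀ k, π (p.2 k) = f k p.1})

/-- The projection of the fibre product. -/
def proj (p : FibreProduct h f) : W := p.1.1

/-- The (abelian) group `Gᴷ` acts on the fibre product componentwise. -/
instance : AddAction (K → G) (FibreProduct h f) where
  vadd g p := ⟨(p.1.1, fun k ↦ g k +ᵥ p.1.2 k), fun k ↦ by rw [h.proj_vadd]; exact p.2 k⟩
  zero_vadd p := Subtype.ext (Prod.ext rfl (funext fun k ↦ zero_vadd G _))
  add_vadd g g' p := Subtype.ext (Prod.ext rfl (funext fun k ↦ add_vadd _ _ _))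

/-- The fibre product is a principal `Gᴷ`-bundle. -/
lemma isPrincipalBundle [Finite K] (hf : ∀ k, Continuous (f k)) :
    IsPrincipalBundle (K → G) (proj h f) := by
  refine ⟨fun _ _ ↦ rfl, fun w ↦ ?_⟩
  choose τ hb hτ using fun k ↦ h.exists_trivialization (f k w)
  have hproj : Continuous (proj h f) := continuous_fst.comp continuous_subtype_val
  have hcomp : ∀ k, Continuous fun p : FibreProduct h f ↦ p.1.2 k := fun k ↦
    (continuous_apply k).comp (continuous_snd.comp continuous_subtype_val)
  classical
  have hW : ∀ k, Nonempty E := fun k ↦ ⟨(τ k).toOpenPartialHomeomorph.symm (f k w, 0)⟩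
  let S : Set W := {u | ∀ k, f k u ∈ (τ k).baseSet}
  have hS : IsOpen S := by
    have : S = ⋂ k, f k ⁻¹' (τ k).baseSet := by ext; simp [S]
    rw [this]
    exact isOpen_iInter_of_finite fun k ↦ (τ k).open_baseSet.preimage (hf k)
  have hwS : w ∈ S := hb
  let s : W × (K → G) → W × (K → E) := fun p ↦
    (p.1, fun k ↦ (τ k).toOpenPartialHomeomorph.symm (f k p.1, p.2 k))
  have hs : ∀ p : W × (K → G), p.1 ∈ S → ∀ k, π ((s p).2 k) = f k (s p).1 :=
    fun p hp k ↦ (τ k).proj_symm_apply' (hp k)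
  let p₀ : FibreProduct h f := ⟨s (w, 0), hs (w, 0) hwS⟩
  let s' : W × (K → G) → FibreProduct h f := fun p ↦
    if hp : p.1 ∈ S then ⟨s p, hs p hp⟩ else p₀
  have hs' : ∀ p : W × (K → G), p.1 ∈ S → (s' p).1 = s p := fun p hp ↦ by
    have : s' p = ⟨s p, hs p hp⟩ := dif_pos hp
    rw [this]
  obtain ⟨τ', hτ', hτ'f⟩ := exists_trivialization_of (G := K → G) hproj hS
    (fun p k ↦ (τ k (p.1.2 k)).2) s'
    (by
      refine continuousOn_pi.2 fun k ↦ ?_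
      refine (continuousOn_triv_snd (τ k)).comp (hcomp k).continuousOn fun p hp ↦ ?_
      rw [mem_preimage, p.2 k]
      exact hp k)
    (by
      have hi : IsInducing fun p : FibreProduct h f ↦ p.1 := IsInducing.subtypeVal
      refine hi.continuousOn_iff.2 ?_
      have : ContinuousOn s (S ×ˢ univ) := by
        refine continuous_fst.continuousOn.prodMk (continuousOn_pi.2 fun k ↦ ?_)
        refine (continuousOn_triv_symm (τ k)).comp (Continuous.continuousOn ?_)
          fun p hp ↦ ⟨hp.1 k, mem_univ _⟩
        exact ((hf k).comp continuous_fst).prodMk ((continuous_apply k).comp continuous_snd)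
      exact this.congr fun p hp ↦ hs' p hp.1)
    (fun b hb g ↦ by rw [proj, hs' (b, g) hb])
    (fun b hb g ↦ by
      funext k
      rw [hs' (b, g) hb]
      simp only [s]
      rw [(τ k).apply_symm_apply' (hb k)])
    (fun p hp ↦ by
      refine Subtype.ext ?_
      rw [hs' _ hp]
      refine Prod.ext rfl (funext fun k ↦ ?_)
      have hk : π (p.1.2 k) ∈ (τ k).baseSet := by rw [p.2 k]; exact hp k
      change (τ k).toOpenPartialHomeomorph.symm (f k p.1.1, (τ k (p.1.2 k)).2) = p.1.2 k
      rw [← p.2 k]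
      exact triv_symm_snd (τ k) hk)
  refine ⟨τ', hτ' ▸ hwS, fun g p hp ↦ ?_⟩
  rw [hτ'f, hτ'f]
  funext k
  rw [hτ'] at hp
  exact hτ k (g k) (p.1.2 k) (by rw [p.2 k]; exact hp k)

end FibreProduct

end FibreProduct

/-! ## The Poincaré bundle -/

/-- The `n`-torus, with the circle written additively as `ℝ / ℤ`. -/
abbrev Torus (n : ℕ) : Type := Fin n → UnitAddCircle

lemma coe_intCast (k : ℤ) : ((k : ℝ) : UnitAddCircle) = 0 :=
  (AddCircle.coe_eq_zero_iff (1 : ℝ)).2 ⟨k, by simp⟩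

/-- The relation `(a, â, t) ∼ (a + n, â + m, nâ + t)`, for integers `n` and `m`. -/
def poincareSetoid : Setoid (ℝ × ℝ × UnitAddCircle) where
  r p q := ∃ n m : ℤ, q.1 = p.1 + n ∧ q.2.1 = p.2.1 + m ∧
    q.2.2 = ((n * p.2.1 : ℝ) : UnitAddCircle) + p.2.2
  iseqv :=
    { refl := fun p ↦ ⟨0, 0, by simp⟩
      symm := by
        rintro p q ⟨n, m, h1, h2, h3⟩
        refine ⟨-n, -m, by simp [h1], by simp [h2], ?_⟩
        have : ((((-n : ℤ) : ℝ) * q.2.1 : ℝ) : UnitAddCircle) = -((n * p.2.1 : ℝ)) := by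
          rw [h2, show (((-n : ℤ) : ℝ) * (p.2.1 + m) : ℝ)
            = -(n * p.2.1) + ((-(n * m) : ℤ) : ℝ) by push_cast; ring]
          rw [AddCircle.coe_add, coe_intCast, add_zero, AddCircle.coe_neg]
        rw [this, h3]; simp
      trans := by
        rintro p q r ⟨n, m, h1, h2, h3⟩ ⟨n', m', h4, h5, h6⟩
        refine ⟨n + n', m + m', by rw [h4, h1]; push_cast; ring, by rw [h5, h2]; push_cast; ring, ?_⟩
        rw [h6, h3, ← add_assoc, ← AddCircle.coe_add, h2,
          show ((n' : ℝ) * (p.2.1 + m) + n * p.2.1 : ℝ)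
            = ((n + n' : ℤ) : ℝ) * p.2.1 + ((n' * m : ℤ) : ℝ) by push_cast; ring]
        rw [AddCircle.coe_add, coe_intCast, add_zero] }

/-- The total space of the Poincaré bundle. -/
def Poincare : Type := Quotient poincareSetoid

namespace Poincare

instance : TopologicalSpace Poincare :=
  inferInstanceAs (TopologicalSpace (Quotient poincareSetoid))

/-- The class of `(a, â, t)`. -/
def mk (a â : ℝ) (t : UnitAddCircle) : Poincare := Quotient.mk poincareSetoid (a, â, t)

lemma mk_eq_mk (a â : ℝ) (t : UnitAddCircle) (n m : ℤ) :
    mk (a + n) (â + m) (((n * â : ℝ) : UnitAddCircle) + t) = mk a â t :=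
  Quotient.sound (poincareSetoid.symm ⟨n, m, rfl, rfl, rfl⟩)

/-- The projection of the Poincaré bundle to the two-dimensional torus. -/
def proj : Poincare → UnitAddCircle × UnitAddCircle :=
  Quotient.lift (fun p : ℝ × ℝ × UnitAddCircle ↦ ((p.1 : UnitAddCircle), (p.2.1 : UnitAddCircle)))
    fun p q ⟨n, m, h1, h2, _⟩ ↦ by simp [h1, h2]

instance : AddAction UnitAddCircle Poincare where
  vadd s := Quotient.map (fun p : ℝ × ℝ × UnitAddCircle ↦ (p.1, p.2.1, s + p.2.2))
    fun p q ⟨n, m, h1, h2, h3⟩ ↦ ⟨n, m, h1, h2, by simp only [h3]; abel⟩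
  zero_vadd := by rintro ⟨a, â, t⟩; exact congrArg (mk a â) (zero_add t)
  add_vadd := by rintro s s' ⟨a, â, t⟩; exact congrArg (mk a â) (add_assoc s s' t)

lemma exists_mk (q : Poincare) : ∃ a â t, mk a â t = q := by
  obtain ⟨⟨a, â, t⟩⟩ := q; exact ⟨a, â, t, rfl⟩

@[simp] lemma proj_mk (a â : ℝ) (t : UnitAddCircle) : proj (mk a â t) = (↑a, ↑â) := rfl

lemma vadd_mk (s : UnitAddCircle) (a â : ℝ) (t : UnitAddCircle) :
    s +ᵥ mk a â t = mk a â (s + t) := rfl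

lemma continuous_proj : Continuous proj := Continuous.quotient_lift (by fun_prop) _

/-- The Poincaré bundle is a principal circle bundle. -/
lemma isPrincipalBundle : IsPrincipalBundle UnitAddCircle proj where
  proj_vadd := by rintro s ⟨a, â, t⟩; rfl
  exists_trivialization b := by
    obtain ⟨⟨α₀, hα₀⟩, ⟨β₀, hβ₀⟩⟩ := And.intro
      (QuotientAddGroup.mk_surjective b.1) (QuotientAddGroup.mk_surjective b.2)
    let τ : ℝ → OpenPartialHomeomorph ℝ UnitAddCircle :=
      fun x ↦ AddCircle.openPartialHomeomorphCoe 1 (x - 1 / 2)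
    let L : ℝ → UnitAddCircle → ℝ := fun x ↦ (τ x).symm
    have hL : ∀ x c, ((L x c : ℝ) : UnitAddCircle) = c := fun x c ↦
      (AddCircle.equivIco (1 : ℝ) (x - 1 / 2)).symm_apply_apply c
    have hmem : ∀ x : ℝ, (x : UnitAddCircle) ∈ (τ x).target := fun x ↦
      (τ x).map_source (x := x) (by
        change x ∈ Ioo _ _
        constructor <;> norm_num
        linarith)
    have hLc : ∀ x, ContinuousOn (L x) (τ x).target := fun x ↦ (τ x).continuousOn_symm
    let S : Set (UnitAddCircle × UnitAddCircle) := (τ α₀).target ×ˢ (τ β₀).target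
    have hS : IsOpen S := (τ α₀).open_target.prod (τ β₀).open_target
    have hint : ∀ a : ℝ, ∃ k : ℤ, a - L α₀ a = k := fun a ↦ by
      have h0 : ((a - L α₀ a : ℝ) : UnitAddCircle) = 0 := by
        rw [AddCircle.coe_sub, hL, sub_self]
      obtain ⟨k, hk⟩ := (AddCircle.coe_eq_zero_iff (1 : ℝ)).1 h0
      exact ⟨k, by rw [← hk]; simp⟩
    let f : Poincare → UnitAddCircle := Quotient.lift
      (fun p : ℝ × ℝ × UnitAddCircle ↦ p.2.2 - (((p.1 - L α₀ p.1) * p.2.1 : ℝ) : UnitAddCircle))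
      (by
        rintro p q ⟨n, m, h1, h2, h3⟩
        obtain ⟨k, hk⟩ := hint p.1
        have hq : ((q.1 : ℝ) : UnitAddCircle) = p.1 := by simp [h1]
        rw [hq, h3, h1, h2, show ((p.1 + n - L α₀ p.1) * (p.2.1 + m) : ℝ)
          = n * p.2.1 + (p.1 - L α₀ p.1) * p.2.1 + (((k + n) * m : ℤ) : ℝ) by
            push_cast; rw [← hk]; ring]
        rw [AddCircle.coe_add, coe_intCast, add_zero, AddCircle.coe_add, add_sub_add_left_eq_sub])
    have hf : ∀ a â t, f (mk a â t) = t - (((a - L α₀ a) * â : ℝ) : UnitAddCircle) :=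
      fun _ _ _ ↦ rfl
    have hmk : IsQuotientMap fun p : ℝ × ℝ × UnitAddCircle ↦ mk p.1 p.2.1 p.2.2 :=
      isQuotientMap_quotient_mk'
    obtain ⟨τ', hτ', hτ'f⟩ := exists_trivialization_of continuous_proj hS f
      (fun p ↦ mk (L α₀ p.1.1) (L β₀ p.1.2) p.2)
      (by
        refine (hmk.continuousOn_isOpen_iff (hS.preimage continuous_proj)).2 ?_
        change ContinuousOn (fun p : ℝ × ℝ × UnitAddCircle ↦
          p.2.2 - (((p.1 - L α₀ p.1) * p.2.1 : ℝ) : UnitAddCircle)) _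
        refine ContinuousOn.sub (by fun_prop) ?_
        refine (AddCircle.continuous_mk' (1 : ℝ)).comp_continuousOn ?_
        refine ContinuousOn.mul (ContinuousOn.sub (by fun_prop) ?_) (by fun_prop)
        exact (hLc α₀).comp (((AddCircle.continuous_mk' (1 : ℝ)).comp
          continuous_fst).continuousOn) fun p hp ↦ hp.1)
      (by
        refine hmk.continuous.comp_continuousOn (f := fun p : (UnitAddCircle × UnitAddCircle) ×
          UnitAddCircle ↦ (L α₀ p.1.1, L β₀ p.1.2, p.2)) ?_
        refine ContinuousOn.prodMk ?_ (ContinuousOn.prodMk ?_ (by fun_prop))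
        · exact (hLc α₀).comp (by fun_prop) fun p hp ↦ hp.1.1
        · exact (hLc β₀).comp (by fun_prop) fun p hp ↦ hp.1.2)
      (fun b _ g ↦ by rw [proj_mk, hL, hL])
      (fun b _ g ↦ by rw [hf, hL]; simp)
      (fun q _ ↦ by
        obtain ⟨a, â, t, rfl⟩ := exists_mk q
        rw [hf, proj_mk]
        obtain ⟨k, hk⟩ := hint a
        have h0 : ((â - L β₀ â : ℝ) : UnitAddCircle) = 0 := by
          rw [AddCircle.coe_sub, hL, sub_self]
        obtain ⟨m, hm⟩ := (AddCircle.coe_eq_zero_iff (1 : ℝ)).1 h0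
        have hm' : â - L β₀ â = m := by rw [← hm]; simp
        have := mk_eq_mk a â t (-k) (-m)
        rw [← this]
        congr 1
        · push_cast; linarith
        · push_cast; linarith
        · rw [hk, show (((-k : ℤ) : ℝ) * â : ℝ) = -(k * â) by push_cast; ring]
          rw [AddCircle.coe_neg, neg_add_eq_sub])
    refine ⟨τ', ?_, ?_⟩
    · rw [hτ']
      refine ⟨?_, ?_⟩
      · rw [← hα₀]; exact hmem α₀
      · rw [← hβ₀]; exact hmem β₀
    · intro s q _
      obtain ⟨a, â, t, rfl⟩ := exists_mk q
      rw [hτ'f, hτ'f, vadd_mk, hf, hf, add_sub_assoc]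

end Poincare

/-- The additive group `so(n, ℤ)` of skew-symmetric integer matrices. -/
abbrev SOZ (n : ℕ) : Type := LieAlgebra.Orthogonal.so (Fin n) ℤ

/-- The pairs of indices `j < i`; the pair `k` consists of `i = k.1.1` and `j = k.1.2`. -/
abbrev Pairs (n : ℕ) : Type := {k : Fin n × Fin n // k.2 < k.1}

section Tensor

variable {n : ℕ}

/-- The entry `B_{pq}`, as a homomorphism `so(n, ℤ) → ℤ`. -/
def entry (p q : Fin n) : SOZ n →+ ℤ where
  toFun B := B.1 p q
  map_zero' := rfl
  map_add' _ _ := rfl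

lemma continuous_entry (p q : Fin n) : Continuous (entry p q) :=
  (continuous_apply q).comp ((continuous_apply p).comp continuous_subtype_val)

/-- The homomorphism `(t_{ij}) ↦ ∑_{j < i} B_{ij} t_{ij}`. Extension of the structure group along it
is the tensor product of the `B_{ij}`-th tensor powers of circle bundles. -/
def weight (B : SOZ n) : (Pairs n → UnitAddCircle) →+ UnitAddCircle where
  toFun t := ∑ k, entry k.1.1 k.1.2 B • t k
  map_zero' := by simp
  map_add' s t := by simp [smul_add, Finset.sum_add_distrib]

lemma weight_add (B B' : SOZ n) (t : Pairs n → UnitAddCircle) :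
    weight (B + B') t = weight B t + weight B' t := by
  simp [weight, add_smul, Finset.sum_add_distrib]

lemma continuous_weight :
    Continuous fun p : SOZ n × (Pairs n → UnitAddCircle) ↦ weight p.1 p.2 := by
  refine continuous_finsetSum _ fun k _ ↦ ?_
  have h : Continuous fun p : ℤ × UnitAddCircle ↦ p.1 • p.2 :=
    continuous_prod_of_discrete_left.2 fun m ↦ continuous_zsmul m
  exact h.comp (((continuous_entry k.1.1 k.1.2).comp continuous_fst).prodMk
    ((continuous_apply k).comp continuous_snd))

variable {W : Type*} [TopologicalSpace W] (B : W → SOZ n) (a : W → Torus n)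

/-- The fibre product of the pullbacks of the Poincaré bundle along `(a_i, a_j)`, for `j < i`. -/
abbrev PoincareFrames : Type _ :=
  FibreProduct Poincare.isPrincipalBundle fun (k : Pairs n) (w : W) ↦ (a w k.1.1, a w k.1.2)

lemma isPrincipalBundle_frames (ha : Continuous a) : IsPrincipalBundle (Pairs n → UnitAddCircle)
    (FibreProduct.proj Poincare.isPrincipalBundle
      fun (k : Pairs n) (w : W) ↦ (a w k.1.1, a w k.1.2)) :=
  FibreProduct.isPrincipalBundle _ _ fun _ ↦
    ((continuous_apply _).comp ha).prodMk ((continuous_apply _).comp ha)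

/-- The total space of the pullback along `a` of the generalized Poincaré bundle
`⨂_{j < i} pr_{ij}^* 𝒫^{⊗ B_{ij}}` on the `n`-torus, where `B` may vary with the point. -/
abbrev PoincareTensor (ha : Continuous a) : Type _ :=
  Extension (isPrincipalBundle_frames a ha) fun w ↦ weight (B w)

lemma isPrincipalBundle_poincareTensor (hB : Continuous B) (ha : Continuous a) :
    IsPrincipalBundle UnitAddCircle
      (Extension.proj (isPrincipalBundle_frames a ha) fun w ↦ weight (B w)) :=
  Extension.isPrincipalBundle _
    (continuous_weight.comp ((hB.comp continuous_fst).prodMk continuous_snd))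

end Tensor

/-! ## Bundle gerbes -/

/-- A circle bundle gerbe over `M`: a map `Y → M` with local sections through every point, a
principal circle bundle `P` over `Y ×_M Y`, and an associative bundle gerbe product
`P_{y₁,y₂} ⊗ P_{y₂,y₃} → P_{y₁,y₃}`, written as a map that is equivariant in both arguments. -/
structure BundleGerbe.{u, v} (M : Type u) [TopologicalSpace M] where
  Y : Type v
  [topY : TopologicalSpace Y]
  proj : Y → M
  continuous_proj : Continuous proj
  surjective_proj : Function.Surjective proj
  exists_section : ∀ y : Y, ∃ (U : Set M) (s : M → Y), IsOpen U ∧ proj y ∈ U ∧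
    ContinuousOn s U ∧ (∀ u ∈ U, proj (s u) = u) ∧ s (proj y) = y
  P : Type v
  [topP : TopologicalSpace P]
  [action : AddAction UnitAddCircle P]
  bdl : P → {y : Y × Y // proj y.1 = proj y.2}
  isPrincipalBundle : IsPrincipalBundle UnitAddCircle bdl
  mul : ∀ p q : P, (bdl p).1.2 = (bdl q).1.1 → P
  continuous_mul :
    Continuous fun r : {r : P × P // (bdl r.1).1.2 = (bdl r.2).1.1} ↦ mul r.1.1 r.1.2 r.2
  bdl_mul : ∀ p q h, (bdl (mul p q h)).1 = ((bdl p).1.1, (bdl q).1.2)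
  mul_vadd : ∀ (s t : UnitAddCircle) p q h h',
    mul (s +ᵥ p) (t +ᵥ q) h' = (s + t) +ᵥ mul p q h
  mul_assoc : ∀ p q r h₁ h₂ h₃ h₄, mul (mul p q h₁) r h₃ = mul p (mul q r h₂) h₄

namespace BundleGerbe

attribute [instance] topY topP action

variable {M : Type*} [TopologicalSpace M]

/-- Local data for a bundle gerbe: an open cover `U`, sections `σ` of `Y` over its members, sections
`s` of the pullback of `P` along `(σ_x, σ_y)` over the two-fold overlaps, and real-valued lifts `η`
of the circle-valued Čech cocycle determined by `s_{xy} · s_{yz} = s_{xz} + η_{xyz}`. -/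
structure LocalData (𝒢 : BundleGerbe M) where
  U : Cech.PointedCover M
  σ : M → M → 𝒢.Y
  continuousOn_σ : ∀ x, ContinuousOn (σ x) (U.set x)
  proj_σ : ∀ x, ∀ u ∈ U.set x, 𝒢.proj (σ x u) = u
  s : M → M → M → 𝒢.P
  continuousOn_s : ∀ x y, ContinuousOn (s x y) (U.set x ∩ U.set y)
  bdl_s : ∀ x y, ∀ u ∈ U.set x ∩ U.set y, (𝒢.bdl (s x y u)).1 = (σ x u, σ y u)
  η : Cech.RawCochain ℝ M 2
  continuousOn_η : ∀ x, ContinuousOn (η x) (U.overlap x)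
  mul_s : ∀ x, ∀ u ∈ U.overlap x, ∀ h, 𝒢.mul (s (x 0) (x 1) u) (s (x 1) (x 2) u) h
    = (η x u : UnitAddCircle) +ᵥ s (x 0) (x 2) u

/-- `ξ` is a Dixmier–Douady class of the bundle gerbe: it is represented by the integral cocycle
`dη`, for some choice of local data. -/
def IsDixmierDouadyClass (𝒢 : BundleGerbe M) (ξ : Cech.H ℤ M 3) : Prop :=
  ∃ (D : 𝒢.LocalData) (c : Cech.RawCochain ℤ M 3) (hc : c ∈ Cech.cocycles ℤ M 3),
    (∀ x, ∀ u ∈ D.U.overlap x, (c x u : ℝ) = Cech.d 2 D.η x u) ∧ Cech.H.mk c hc = ξ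

end BundleGerbe

/-! ## The bundle gerbe of a principal `so(n, ℤ)`-bundle -/

section SonGerbe

variable {X : Type*} [TopologicalSpace X] {n : ℕ} {Z : Type*} [TopologicalSpace Z]
  [AddAction (SOZ n) Z] {π : Z → X} (hZ : IsPrincipalBundle (SOZ n) π)

/-- The class `[Z^{pq}] ∈ H¹(X, ℤ)` of the principal `ℤ`-bundle `Z^{pq} = (pr_{pq})_*(Z)`. -/
def componentClass (p q : Fin n) : Cech.H ℤ X 1 :=
  (Extension.isPrincipalBundle hZ (φ := fun _ ↦ entry p q)
    ((continuous_entry p q).comp continuous_snd)).cls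

namespace SonGerbe

/-- The projection `Z × 𝕋ⁿ → X × 𝕋ⁿ`. -/
def proj (_ : IsPrincipalBundle (SOZ n) π) : Z × Torus n → X × Torus n := Prod.map π id

/-- The fibre product `Z^{[2]} × 𝕋ⁿ` of `Z × 𝕋ⁿ` with itself over `X × 𝕋ⁿ`. -/
abbrev Y2 : Type _ := {y : (Z × Torus n) × (Z × Torus n) // proj hZ y.1 = proj hZ y.2}

/-- The difference map `Z^{[2]} → so(n, ℤ)`, with `z₂ = B(z₁, z₂) + z₁`. -/
def B (w : Y2 hZ) : SOZ n := hZ.diff w.1.1.1 w.1.2.1 (congrArg Prod.fst w.2)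

/-- The projection to `𝕋ⁿ`. -/
def tor (w : Y2 hZ) : Torus n := w.1.1.2

lemma tor_eq (w : Y2 hZ) : w.1.2.2 = tor hZ w := (congrArg Prod.snd w.2).symm

lemma continuous_B : Continuous (B hZ) :=
  hZ.continuous_diff.comp (f := fun w : Y2 hZ ↦
    (⟨(w.1.1.1, w.1.2.1), congrArg Prod.fst w.2⟩ : {p : Z × Z // π p.1 = π p.2})) (by fun_prop)

lemma continuous_tor : Continuous (tor hZ) := by unfold tor; fun_prop

/-- The bundle `pr_{𝕋ⁿ}^* 𝒫_B` over `Z^{[2]} × 𝕋ⁿ`. -/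
abbrev P : Type _ := PoincareTensor (B hZ) (tor hZ) (continuous_tor hZ)

/-- Its bundle projection. -/
abbrev bdl : P hZ → Y2 hZ :=
  Extension.proj (isPrincipalBundle_frames (tor hZ) (continuous_tor hZ)) fun w ↦ weight (B hZ w)

/-- The fibre product of pullbacks of Poincaré bundles of which `P` is an extension. -/
abbrev Fr : Type _ := PoincareFrames (tor hZ)

/-- The class of `(e, t)` in `P`. -/
abbrev mk (e : Fr hZ) (t : UnitAddCircle) : P hZ :=
  Extension.mk (isPrincipalBundle_frames (tor hZ) (continuous_tor hZ)) (fun w ↦ weight (B hZ w)) e t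

/-- Composition of pairs in `Z^{[2]} × 𝕋ⁿ`. -/
def compose (w w' : Y2 hZ) (h : w.1.2 = w'.1.1) : Y2 hZ :=
  ⟨(w.1.1, w'.1.2), w.2.trans ((congrArg (proj hZ) h).trans w'.2)⟩

lemma B_compose (w w' : Y2 hZ) (h : w.1.2 = w'.1.1) :
    B hZ (compose hZ w w' h) = B hZ w + B hZ w' := by
  obtain ⟨⟨y, y'⟩, hw⟩ := w
  obtain ⟨⟨y₁, y''⟩, hw'⟩ := w'
  obtain rfl : y' = y₁ := h
  exact (hZ.diff_add_diff _ _ _ _ _ _).symm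

lemma tor_compose (w w' : Y2 hZ) (h : w.1.2 = w'.1.1) : tor hZ w' = tor hZ w := by
  rw [← tor_eq hZ w, h]; rfl

/-- A point of the fibre over a pair `w = (y₁, y₂)`, moved to the fibre over `(y₁, y₃)`. -/
def move (e : Fr hZ) (w' : Y2 hZ) (h : e.1.1.1.2 = w'.1.1) : Fr hZ :=
  ⟨(compose hZ e.1.1 w' h, e.1.2), e.2⟩

lemma proj_frame_eq (e e' : Fr hZ) (h : e.1.1.1.2 = e'.1.1.1.1) (k : Pairs n) :
    Poincare.proj (e.1.2 k) = Poincare.proj (e'.1.2 k) := by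
  have ht := tor_compose hZ e.1.1 e'.1.1 h
  refine (e.2 k).trans (Eq.trans ?_ (e'.2 k).symm)
  exact Prod.ext (congrFun ht.symm k.1.1) (congrFun ht.symm k.1.2)

/-- The difference of two families of points of the same fibres of the Poincaré bundle. -/
def frameDiff (e e' : Fr hZ) (h : e.1.1.1.2 = e'.1.1.1.1) (k : Pairs n) : UnitAddCircle :=
  Poincare.isPrincipalBundle.diff (e.1.2 k) (e'.1.2 k) (proj_frame_eq hZ e e' h k)

/-- The bundle gerbe product on representatives. By the equality `B₁₃ = B₁₂ + B₂₃` it is the canonical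
isomorphism `𝒫_{B₁₂} ⊗ 𝒫_{B₂₃} ≅ 𝒫_{B₁₃}`, which for equal families `v` sends
`[v, t] ⊗ [v, t']` to `[v, t + t']`. -/
def mulRep (e e' : Fr hZ) (t t' : UnitAddCircle) (h : e.1.1.1.2 = e'.1.1.1.1) : P hZ :=
  mk hZ (move hZ e e'.1.1 h) (t + t' + weight (B hZ e'.1.1) (frameDiff hZ e e' h))

lemma mulRep_eq {e e' e₁ e₁' : Fr hZ} {t t' t₁ t₁' : UnitAddCircle} (h : e.1.1.1.2 = e'.1.1.1.1)
    (h₁ : e₁.1.1.1.2 = e₁'.1.1.1.1) (he : mk hZ e t = mk hZ e₁ t₁)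
    (he' : mk hZ e' t' = mk hZ e₁' t₁') : mulRep hZ e e' t t' h = mulRep hZ e₁ e₁' t₁ t₁' h₁ := by
  obtain ⟨g, h2, h3⟩ := Quotient.exact he
  obtain ⟨g', h4, h5⟩ := Quotient.exact he'
  dsimp only at h2 h3 h4 h5
  subst h2 h4
  have h6 : frameDiff hZ (g +ᵥ e) (g' +ᵥ e') h₁ = g' + frameDiff hZ e e' h - g := by
    funext k
    exact Poincare.isPrincipalBundle.diff_vadd_vadd _ _ _ _ _ _
  have h7 : move hZ (g +ᵥ e) (g' +ᵥ e').1.1 h₁ = g +ᵥ move hZ e e'.1.1 h := rfl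
  have h8 : B hZ (g' +ᵥ e').1.1 = B hZ e'.1.1 := rfl
  have h9 : weight (B hZ (compose hZ e.1.1 e'.1.1 h)) g
      = weight (B hZ e.1.1) g + weight (B hZ e'.1.1) g := by rw [B_compose, weight_add]
  have h3' : t = weight (B hZ e.1.1) g + t₁ := h3
  have h5' : t' = weight (B hZ e'.1.1) g' + t₁' := h5
  rw [mulRep, mulRep, h6, h7, h8, mk, mk, Extension.mk_vadd]
  congr 1
  change _ = weight (B hZ (compose hZ e.1.1 e'.1.1 h)) g + _
  rw [h9, h3', h5', map_sub, map_add]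
  abel

/-- The bundle gerbe product. -/
def mul (p q : P hZ) (h : (bdl hZ p).1.2 = (bdl hZ q).1.1) : P hZ :=
  mulRep hZ (Quotient.out p).1 (Quotient.out q).1 (Quotient.out p).2 (Quotient.out q).2 (by
    have hp : mk hZ (Quotient.out p).1 (Quotient.out p).2 = p := Quotient.out_eq p
    have hq : mk hZ (Quotient.out q).1 (Quotient.out q).2 = q := Quotient.out_eq q
    rw [← hp, ← hq] at h
    exact h)

lemma mul_mk (e e' : Fr hZ) (t t' : UnitAddCircle) (h : e.1.1.1.2 = e'.1.1.1.1) :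
    mul hZ (mk hZ e t) (mk hZ e' t') h = mulRep hZ e e' t t' h :=
  mulRep_eq hZ _ _ (Quotient.out_eq (mk hZ e t)) (Quotient.out_eq (mk hZ e' t'))

lemma continuous_mul : Continuous
    fun r : {r : P hZ × P hZ // (bdl hZ r.1).1.2 = (bdl hZ r.2).1.1} ↦ mul hZ r.1.1 r.1.2 r.2 := by
  have hq : IsOpenQuotientMap fun p : Fr hZ × UnitAddCircle ↦ mk hZ p.1 p.2 :=
    Extension.isOpenQuotientMap_mk _ fun g ↦
      continuous_weight.comp ((continuous_B hZ).prodMk continuous_const)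
  have hqq := (hq.prodMap hq).restrictPreimage
    {r : P hZ × P hZ | (bdl hZ r.1).1.2 = (bdl hZ r.2).1.1}
  refine hqq.continuous_comp_iff.1 ?_
  let T := {r : (Fr hZ × UnitAddCircle) × (Fr hZ × UnitAddCircle) //
    r.1.1.1.1.1.2 = r.2.1.1.1.1.1}
  suffices Continuous fun r : T ↦ mulRep hZ r.1.1.1 r.1.2.1 r.1.1.2 r.1.2.2 r.2 by
    refine this.congr fun r ↦ ?_
    exact (mul_mk hZ r.1.1.1 r.1.2.1 r.1.1.2 r.1.2.2 r.2).symm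
  have c1 : Continuous fun r : T ↦ r.1.1.1 :=
    continuous_fst.comp (continuous_fst.comp continuous_subtype_val)
  have c2 : Continuous fun r : T ↦ r.1.2.1 :=
    continuous_fst.comp (continuous_snd.comp continuous_subtype_val)
  have c3 : Continuous fun r : T ↦ r.1.1.2 :=
    continuous_snd.comp (continuous_fst.comp continuous_subtype_val)
  have c4 : Continuous fun r : T ↦ r.1.2.2 :=
    continuous_snd.comp (continuous_snd.comp continuous_subtype_val)
  have cw : Continuous fun e : Fr hZ ↦ e.1.1 := continuous_fst.comp continuous_subtype_val
  have cv : ∀ k, Continuous fun e : Fr hZ ↦ e.1.2 k := fun k ↦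
    (continuous_apply k).comp (continuous_snd.comp continuous_subtype_val)
  have cm : Continuous fun r : T ↦ move hZ r.1.1.1 r.1.2.1.1.1 r.2 := by
    refine Continuous.subtype_mk (Continuous.prodMk ?_ ?_) _
    · refine Continuous.subtype_mk (Continuous.prodMk ?_ ?_) _
      · exact continuous_fst.comp (continuous_subtype_val.comp (cw.comp c1))
      · exact continuous_snd.comp (continuous_subtype_val.comp (cw.comp c2))
    · exact continuous_snd.comp (continuous_subtype_val.comp c1)
  have cd : Continuous fun r : T ↦ frameDiff hZ r.1.1.1 r.1.2.1 r.2 := by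
    refine continuous_pi fun k ↦ ?_
    exact Poincare.isPrincipalBundle.continuous_diff.comp (f := fun r : T ↦
      (⟨(r.1.1.1.1.2 k, r.1.2.1.1.2 k), proj_frame_eq hZ _ _ r.2 k⟩ :
        {p : Poincare × Poincare // Poincare.proj p.1 = Poincare.proj p.2}))
      (Continuous.subtype_mk (((cv k).comp c1).prodMk ((cv k).comp c2)) _)
  exact hq.continuous.comp (cm.prodMk ((c3.add c4).add
    (continuous_weight.comp (((continuous_B hZ).comp (cw.comp c2)).prodMk cd))))

lemma exists_mk (p : P hZ) : ∃ e t, mk hZ e t = p := Extension.exists_mk _ _ p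

lemma bdl_mul (p q : P hZ) (h : (bdl hZ p).1.2 = (bdl hZ q).1.1) :
    (bdl hZ (mul hZ p q h)).1 = ((bdl hZ p).1.1, (bdl hZ q).1.2) := by
  obtain ⟨e, t, rfl⟩ := exists_mk hZ p
  obtain ⟨e', t', rfl⟩ := exists_mk hZ q
  rw [mul_mk hZ e e' t t' h]
  rfl

lemma mul_vadd (s s' : UnitAddCircle) (p q : P hZ) (h : (bdl hZ p).1.2 = (bdl hZ q).1.1)
    (h' : (bdl hZ (s +ᵥ p)).1.2 = (bdl hZ (s' +ᵥ q)).1.1) :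
    mul hZ (s +ᵥ p) (s' +ᵥ q) h' = (s + s') +ᵥ mul hZ p q h := by
  obtain ⟨e, t, rfl⟩ := exists_mk hZ p
  obtain ⟨e', t', rfl⟩ := exists_mk hZ q
  rw [mul_mk hZ e e' t t' h]
  refine (mul_mk hZ e e' (s + t) (s' + t') h).trans ?_
  have : s + t + (s' + t') + weight (B hZ e'.1.1) (frameDiff hZ e e' h)
      = s + s' + (t + t' + weight (B hZ e'.1.1) (frameDiff hZ e e' h)) := by abel
  exact congrArg (mk hZ (move hZ e e'.1.1 h)) this

lemma mul_assoc (p q r : P hZ) (h₁ : (bdl hZ p).1.2 = (bdl hZ q).1.1)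
    (h₂ : (bdl hZ q).1.2 = (bdl hZ r).1.1) (h₃ : (bdl hZ (mul hZ p q h₁)).1.2 = (bdl hZ r).1.1)
    (h₄ : (bdl hZ p).1.2 = (bdl hZ (mul hZ q r h₂)).1.1) :
    mul hZ (mul hZ p q h₁) r h₃ = mul hZ p (mul hZ q r h₂) h₄ := by
  obtain ⟨e, t, rfl⟩ := exists_mk hZ p
  obtain ⟨e', t', rfl⟩ := exists_mk hZ q
  obtain ⟨e'', t'', rfl⟩ := exists_mk hZ r
  have h₁' : e.1.1.1.2 = e'.1.1.1.1 := h₁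
  have h₂' : e'.1.1.1.2 = e''.1.1.1.1 := h₂
  have e1 := mul_mk hZ e e' t t' h₁
  have e2 := mul_mk hZ e' e'' t' t'' h₂
  have h₃' : (move hZ e e'.1.1 h₁).1.1.1.2 = e''.1.1.1.1 := h₂
  have h₄' : e.1.1.1.2 = (move hZ e' e''.1.1 h₂).1.1.1.1 := h₁
  have E1 : mul hZ (mul hZ (mk hZ e t) (mk hZ e' t') h₁) (mk hZ e'' t'') h₃
      = mulRep hZ (move hZ e e'.1.1 h₁) e'' (t + t' + weight (B hZ e'.1.1) (frameDiff hZ e e' h₁))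
        t'' h₃' := by
    simp only [e1]; exact mul_mk hZ _ _ _ _ _
  have E2 : mul hZ (mk hZ e t) (mul hZ (mk hZ e' t') (mk hZ e'' t'') h₂) h₄
      = mulRep hZ e (move hZ e' e''.1.1 h₂) t
        (t' + t'' + weight (B hZ e''.1.1) (frameDiff hZ e' e'' h₂)) h₄' := by
    simp only [e2]; exact mul_mk hZ _ _ _ _ _
  rw [E1, E2, mulRep, mulRep]
  have h5 : frameDiff hZ (move hZ e e'.1.1 h₁) e'' h₃'
      = frameDiff hZ e e' h₁ + frameDiff hZ e' e'' h₂ := by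
    funext k
    exact (Poincare.isPrincipalBundle.diff_add_diff _ _ _ _ _ _).symm
  have h6 : frameDiff hZ e (move hZ e' e''.1.1 h₂) h₄' = frameDiff hZ e e' h₁ := rfl
  have h7 : B hZ (move hZ e' e''.1.1 h₂).1.1 = B hZ e'.1.1 + B hZ e''.1.1 :=
    B_compose hZ e'.1.1 e''.1.1 h₂
  have h8 : move hZ (move hZ e e'.1.1 h₁) e''.1.1 h₃'
      = move hZ e (move hZ e' e''.1.1 h₂).1.1 h₄' := rfl
  rw [h5, h6, h7, h8, weight_add, map_add]
  congr 1
  abel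

lemma exists_section (y : Z × Torus n) : ∃ (U : Set (X × Torus n)) (s : X × Torus n → Z × Torus n),
    IsOpen U ∧ proj hZ y ∈ U ∧ ContinuousOn s U ∧ (∀ u ∈ U, proj hZ (s u) = u) ∧
      s (proj hZ y) = y := by
  obtain ⟨τ, hb, -⟩ := hZ.exists_trivialization (π y.1)
  refine ⟨τ.baseSet ×ˢ univ, fun u ↦ (τ.toOpenPartialHomeomorph.symm (u.1, (τ y.1).2), u.2),
    τ.open_baseSet.prod isOpen_univ, ⟨hb, mem_univ _⟩, ?_, ?_, ?_⟩
  · refine ContinuousOn.prodMk ?_ continuous_snd.continuousOn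
    exact (continuousOn_triv_symm τ).comp
      (Continuous.continuousOn (f := fun u : X × Torus n ↦ (u.1, (τ y.1).2)) (by fun_prop))
      fun u hu ↦ ⟨hu.1, mem_univ _⟩
  · exact fun u hu ↦ Prod.ext (τ.proj_symm_apply' hu.1) rfl
  · exact Prod.ext (triv_symm_snd τ hb) rfl

end SonGerbe

/-- The bundle gerbe `ℛ(Z)` over `X × 𝕋ⁿ` of a principal `so(n, ℤ)`-bundle `Z` over `X`. -/
def sonGerbe : BundleGerbe (X × Torus n) where
  Y := Z × Torus n
  proj := SonGerbe.proj hZ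
  continuous_proj := hZ.continuous_proj.prodMap continuous_id
  surjective_proj := hZ.surjective.prodMap Function.surjective_id
  exists_section := SonGerbe.exists_section hZ
  P := SonGerbe.P hZ
  bdl := SonGerbe.bdl hZ
  isPrincipalBundle :=
    isPrincipalBundle_poincareTensor _ _ (SonGerbe.continuous_B hZ) (SonGerbe.continuous_tor hZ)
  mul := SonGerbe.mul hZ
  continuous_mul := SonGerbe.continuous_mul hZ
  bdl_mul := SonGerbe.bdl_mul hZ
  mul_vadd := SonGerbe.mul_vadd hZ
  mul_assoc := SonGerbe.mul_assoc hZ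

end SonGerbe

/-! ## The filtration -/

/-- The step `F_i H^k(E, ℤ)` of the filtration for `π : E → X`: the classes whose pullback along the
induced map `f^*E → E` vanishes, for every continuous map `f : C → X` defined on a CW complex `C` of
dimension at most `i - 1`. -/
def filtration.{u, v} {E : Type v} [TopologicalSpace E] {X : Type u} [TopologicalSpace X]
    (π : C(E, X)) (i k : ℕ) : AddSubgroup (Cech.H ℤ E k) where
  carrier := {ξ | ∀ (C : Type u) [TopologicalSpace C] [T2Space C] [CWComplex (univ : Set C)],
    (∀ m, i ≤ m → IsEmpty (RelCWComplex.cell (univ : Set C) m)) → ∀ f : C(C, X),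
    Cech.pullback (⟨fun p : {p : C × E // f p.1 = π p.2} ↦ p.1.2, by fun_prop⟩ :
      C({p : C × E // f p.1 = π p.2}, E)) ξ = 0}
  zero_mem' := fun _ _ _ _ _ _ ↦ map_zero _
  add_mem' := fun h h' C _ _ _ hC f ↦ by rw [map_add, h C hC f, h' C hC f, add_zero]
  neg_mem' := fun h C _ _ _ hC f ↦ by rw [map_neg, h C hC f, neg_zero]

end TorusGerbe
end

/-!
The Dixmier–Douady class of `ℛ(Z)` is computed from one explicit choice of local data, and it is
shown that every other choice gives the same class.

*The explicit computation.* Cover `X × 𝕋ⁿ` by products of trivializing sets of `Z` and of arcs. Near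
`x`, let `σ_x` be a local section of `Z` and let `Lⁱ_x` be a real-valued lift of the `i`-th
coordinate of the torus. On overlaps `σ_y = z_{xy} + σ_x` with `z_{xy} ∈ so(n, ℤ)`, and
`nⁱ_{xy} = Lⁱ_y - Lⁱ_x` is an integer. The lifts define sections `[Lⁱ_x, Lʲ_x, 0]` of the pullbacks of
the Poincaré bundle, and hence sections of the circle bundle of the gerbe along `(σ_x, σ_y)`. The
relation `(a, â, t) ∼ (a + k, â + m, kâ + t)` shows that the sections of the Poincaré bundle near `x`
and near `y` differ by `-nⁱ_{xy} Lʲ_y` modulo `ℤ` (`SonGerbe.frameDiff_frame`), so that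
`η_{xyw} = -∑_{j < i} z^{ij}_{yw} nⁱ_{xy} Lʲ_y`. As `Lʲ` has coboundary `nʲ` and as `z` and `n` are
cocycles, `δη` is exactly the cochain `∑_{j < i} nⁱ ∪ nʲ ∪ z^{ij}` (`SonGerbe.intCast_cupTerm`). The
cocycle `z^{ij}` represents `[Z^{ij}]` since the class of an extension is the image of the class
(`IsPrincipalBundle.cls_extension`).

*Generators.* The cocycle `n` of the circle generates `Ȟ¹(ℝ/ℤ, ℤ)` freely. Indeed, a partition of
unity exhibits an integral 1-cocycle as the coboundary of real-valued functions, which define a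
map to the circle modulo `ℤ`; its degree is the coefficient of `n`. A generator therefore is
`±[n]`, and the sign cancels in the formula because the generator occurs twice in each summand.

*Independence of choices.* Given two choices of local data, sections of the circle bundle along
`(σ_x, σ'_x)` exist near each point. Comparing the two ways around the square formed by them and by
`s_{xy}`, `s'_{xy}` gives circle-valued functions `a_{xy}`, and associativity of the product shows
that `η' - η ≡ δa` modulo `ℤ`. After a refinement, `a` lifts to real-valued functions, and then
`δη' - δη` is the coboundary of an integral cochain. The refinement uses paracompactness and has to
change the index function of the cover (`PointedCover.exists_refinement`); this does not affect
the class, by the prism homotopy (`reindex_sub_mem_coboundaries`).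

*The filtration.* A zero-dimensional CW complex is discrete and has no first cohomology, so the factor
`[Z^{ij}]` of each summand vanishes after pullback to it.
-/

noncomputable section

/-! ### Čech cochains in low degrees -/

namespace Cech

section Basic

variable {A : Type*} [AddCommGroup A] {M : Type*} {k : ℕ}

lemma d_zero_apply (c : RawCochain A M 0) (x : Fin 2 → M) (u : M) :
    d 0 c x u = c ![x 1] u - c ![x 0] u := by
  have f0 : x ∘ Fin.succAbove 0 = ![x 1] := by funext i; fin_cases i; rfl
  have f1 : x ∘ Fin.succAbove 1 = ![x 0] := by funext i; fin_cases i; rfl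
  simp only [d, AddMonoidHom.coe_mk, ZeroHom.coe_mk]
  rw [Fin.sum_univ_two, f0, f1]
  simp [sub_eq_add_neg]

lemma d_one_apply (c : RawCochain A M 1) (x : Fin 3 → M) (u : M) :
    d 1 c x u = c ![x 1, x 2] u - c ![x 0, x 2] u + c ![x 0, x 1] u := by
  have f0 : x ∘ Fin.succAbove 0 = ![x 1, x 2] := by funext i; fin_cases i <;> rfl
  have f1 : x ∘ Fin.succAbove 1 = ![x 0, x 2] := by funext i; fin_cases i <;> rfl
  have f2 : x ∘ Fin.succAbove 2 = ![x 0, x 1] := by funext i; fin_cases i <;> rfl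
  simp only [d, AddMonoidHom.coe_mk, ZeroHom.coe_mk]
  rw [Fin.sum_univ_three, f0, f1, f2]
  simp [sub_eq_add_neg]

lemma d_two_apply (c : RawCochain A M 2) (x : Fin 4 → M) (u : M) :
    d 2 c x u = c ![x 1, x 2, x 3] u - c ![x 0, x 2, x 3] u + c ![x 0, x 1, x 3] u
      - c ![x 0, x 1, x 2] u := by
  have f0 : x ∘ Fin.succAbove 0 = ![x 1, x 2, x 3] := by funext i; fin_cases i <;> rfl
  have f1 : x ∘ Fin.succAbove 1 = ![x 0, x 2, x 3] := by funext i; fin_cases i <;> rfl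
  have f2 : x ∘ Fin.succAbove 2 = ![x 0, x 1, x 3] := by funext i; fin_cases i <;> rfl
  have f3 : x ∘ Fin.succAbove 3 = ![x 0, x 1, x 2] := by funext i; fin_cases i <;> rfl
  simp only [d, AddMonoidHom.coe_mk, ZeroHom.coe_mk]
  rw [Fin.sum_univ_four, f0, f1, f2, f3]
  simp [sub_eq_add_neg, pow_succ]

lemma d_three_apply (c : RawCochain A M 3) (x : Fin 5 → M) (u : M) :
    d 3 c x u = c ![x 1, x 2, x 3, x 4] u - c ![x 0, x 2, x 3, x 4] u + c ![x 0, x 1, x 3, x 4] u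
      - c ![x 0, x 1, x 2, x 4] u + c ![x 0, x 1, x 2, x 3] u := by
  have f0 : x ∘ Fin.succAbove 0 = ![x 1, x 2, x 3, x 4] := by funext i; fin_cases i <;> rfl
  have f1 : x ∘ Fin.succAbove 1 = ![x 0, x 2, x 3, x 4] := by funext i; fin_cases i <;> rfl
  have f2 : x ∘ Fin.succAbove 2 = ![x 0, x 1, x 3, x 4] := by funext i; fin_cases i <;> rfl
  have f3 : x ∘ Fin.succAbove 3 = ![x 0, x 1, x 2, x 4] := by funext i; fin_cases i <;> rfl
  have f4 : x ∘ Fin.succAbove 4 = ![x 0, x 1, x 2, x 3] := by funext i; fin_cases i <;> rfl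
  simp only [d, AddMonoidHom.coe_mk, ZeroHom.coe_mk]
  rw [Fin.sum_univ_five, f0, f1, f2, f3, f4]
  simp [sub_eq_add_neg, pow_succ]

lemma intCast_d (c : RawCochain ℤ M k) (x : Fin (k + 2) → M) (u : M) :
    ((d k c x u : ℤ) : ℝ) = d k (fun y v ↦ (c y v : ℝ)) x u := by
  simp [d]

end Basic

section Classes

variable {A : Type*} [AddCommGroup A] [TopologicalSpace A] [IsTopologicalAddGroup A]
variable {M : Type*} [TopologicalSpace M] {k : ℕ}

lemma PointedCover.mem_overlap_inf {U V : PointedCover M} {x : Fin (k + 1) → M} {u : M}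
    (hu : u ∈ (U.inf V).overlap x) : u ∈ U.overlap x ∧ u ∈ V.overlap x := by
  rwa [PointedCover.overlap_inf] at hu

lemma H.mk_eq_mk_iff {c c' : RawCochain A M k} {hc : c ∈ cocycles A M k}
    {hc' : c' ∈ cocycles A M k} : H.mk c hc = H.mk c' hc' ↔ c - c' ∈ coboundaries A M k := by
  rw [← neg_mem_iff (H := coboundaries A M k), neg_sub, sub_eq_neg_add]
  exact QuotientAddGroup.eq

lemma H.exists_mk (ξ : H A M k) : ∃ c hc, H.mk c hc = ξ := by
  obtain ⟨⟨c, hc⟩, rfl⟩ := QuotientAddGroup.mk_surjective ξ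
  exact ⟨c, hc, rfl⟩

lemma H.mk_sum {ι : Type*} {s : Finset ι} {c : ι → RawCochain A M k}
    (hc : ∀ i, c i ∈ cocycles A M k) (h : ∑ i ∈ s, c i ∈ cocycles A M k) :
    H.mk (∑ i ∈ s, c i) h = ∑ i ∈ s, H.mk (c i) (hc i) := by
  refine Eq.trans ?_ (map_sum (QuotientAddGroup.mk' _)
    (fun i ↦ (⟨c i, hc i⟩ : cocycles A M k)) s)
  exact congrArg (QuotientAddGroup.mk' _) (Subtype.ext (by simp))

lemma mem_coboundaries_of_eq_d {c : RawCochain A M (k + 1)} {b : RawCochain A M k}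
    (hb : b ∈ cochains A M k) (U : PointedCover M)
    (h : ∀ x, ∀ u ∈ U.overlap x, c x u = d k b x u) : c ∈ coboundaries A M (k + 1) := by
  rw [← sub_add_cancel c (d k b)]
  exact add_mem (AddSubgroup.mem_sup_left ⟨U, fun x u hu ↦ sub_eq_zero.2 (h x u hu)⟩)
    (AddSubgroup.mem_sup_right ⟨b, hb, rfl⟩)

lemma continuousOn_d (U : PointedCover M) {c : RawCochain A M k}
    (hc : ∀ x, ContinuousOn (c x) (U.overlap x)) (x : Fin (k + 2) → M) :
    ContinuousOn (d k c x) (U.overlap x) := by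
  change ContinuousOn (fun u ↦ ∑ i : Fin (k + 2), (-1 : ℤ) ^ (i : ℕ) • c (x ∘ i.succAbove) u) _
  refine continuousOn_finsetSum _ fun i _ ↦ ?_
  exact ((hc (x ∘ i.succAbove)).mono (U.overlap_subset x _)).const_smul ((-1 : ℤ) ^ (i : ℕ))

lemma exists_cover_of_mem_cocycles {c : RawCochain A M k} (hc : c ∈ cocycles A M k) :
    ∃ U : PointedCover M, (∀ x, ContinuousOn (c x) (U.overlap x)) ∧
      ∀ x, ∀ u ∈ U.overlap x, d k c x u = 0 := by
  obtain ⟨⟨U, hU⟩, ⟨V, hV⟩⟩ := hc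
  refine ⟨U.inf V, fun x ↦ (hU x).mono ?_, fun x u hu ↦ hV x u ?_⟩
  · rw [PointedCover.overlap_inf]; exact inter_subset_left
  · exact (PointedCover.mem_overlap_inf hu).2

/-- The change of the index function of a cover does not change the class of a 3-cocycle: the
prism operator `(hc)(x₀, x₁, x₂) = ∑ⱼ (-1)ʲ c(x₀, …, xⱼ, τxⱼ, …, τx₂)` is a homotopy between the
reindexing along `τ` and the identity. -/
lemma reindex_sub_mem_coboundaries {c : RawCochain A M 3} (U V : PointedCover M)
    (hU : ∀ x, ContinuousOn (c x) (U.overlap x))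
    (hdc : ∀ x, ∀ u ∈ U.overlap x, d 3 c x u = 0) (τ : M → M)
    (hτ : ∀ x, V.set x ⊆ U.set (τ x)) :
    (fun x u ↦ c (τ ∘ x) u) - c ∈ coboundaries A M 3 := by
  let b : RawCochain A M 2 := fun x u ↦ c ![x 0, τ (x 0), τ (x 1), τ (x 2)] u
    - c ![x 0, x 1, τ (x 1), τ (x 2)] u + c ![x 0, x 1, x 2, τ (x 2)] u
  have hV : ∀ {l : ℕ} {x : Fin (l + 1) → M} {u : M} (i : Fin (l + 1)), u ∈ (V.inf U).overlap x →
      u ∈ U.set (x i) ∧ u ∈ U.set (τ (x i)) := fun i hu ↦ ⟨(hu i).2, hτ _ (hu i).1⟩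
  refine mem_coboundaries_of_eq_d (b := b) ⟨V.inf U, fun x ↦ ?_⟩ (V.inf U) fun x u hu ↦ ?_
  · refine ContinuousOn.add (ContinuousOn.sub ?_ ?_) ?_
    all_goals
      refine (hU _).mono fun u hu i ↦ ?_
      fin_cases i <;> simp [hV _ hu]
  · have h0 := hdc ![x 0, τ (x 0), τ (x 1), τ (x 2), τ (x 3)] u
      (fun i ↦ by fin_cases i <;> simp [hV _ hu])
    have h1 := hdc ![x 0, x 1, τ (x 1), τ (x 2), τ (x 3)] u
      (fun i ↦ by fin_cases i <;> simp [hV _ hu])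
    have h2 := hdc ![x 0, x 1, x 2, τ (x 2), τ (x 3)] u
      (fun i ↦ by fin_cases i <;> simp [hV _ hu])
    have h3 := hdc ![x 0, x 1, x 2, x 3, τ (x 3)] u
      (fun i ↦ by fin_cases i <;> simp [hV _ hu])
    rw [d_three_apply] at h0 h1 h2 h3
    rw [d_two_apply]
    have e1 : τ ∘ x = ![τ (x 0), τ (x 1), τ (x 2), τ (x 3)] := by
      funext i; fin_cases i <;> rfl
    have e2 : x = ![x 0, x 1, x 2, x 3] := by funext i; fin_cases i <;> rfl
    have e3 : ((fun x u ↦ c (τ ∘ x) u) - c) x u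
        = c ![τ (x 0), τ (x 1), τ (x 2), τ (x 3)] u - c ![x 0, x 1, x 2, x 3] u := by
      rw [← e1, ← e2]; rfl
    rw [e3]
    simp only [b, Matrix.cons_val] at h0 h1 h2 h3 ⊢
    linear_combination (norm := abel) h0 - h1 + h2 - h3

end Classes

/-! ### Real-valued lifts -/

section Lifts

variable {M : Type*} [TopologicalSpace M]

lemma exists_local_lift {S : Set M} (hS : IsOpen S) {f : M → UnitAddCircle} (hf : ContinuousOn f S)
    {u : M} (hu : u ∈ S) : ∃ N ∈ 𝓝 u, ∃ g : M → ℝ, ContinuousOn g N ∧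
      ∀ v ∈ N, (g v : UnitAddCircle) = f v := by
  obtain ⟨t, ht⟩ := QuotientAddGroup.mk_surjective (f u)
  obtain ⟨e, he, hec⟩ := (AddCircle.isLocalHomeomorph_coe (1 : ℝ)) t
  have heu : f u ∈ e.target := by
    rw [← ht]
    change ((t : ℝ) : UnitAddCircle) ∈ _
    rw [congrFun hec t]
    exact e.map_source he
  refine ⟨S ∩ f ⁻¹' e.target, (hf.isOpen_inter_preimage hS e.open_target).mem_nhds ⟨hu, heu⟩,
    fun v ↦ e.symm (f v), ?_, fun v hv ↦ ?_⟩
  · exact e.continuousOn_symm.comp (hf.mono inter_subset_left) fun v hv ↦ hv.2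
  · rw [congrFun hec]
    exact e.right_inv hv.2

lemma continuousOn_round {f : M → ℝ} {S : Set M} (hf : ContinuousOn f S)
    (h : ∀ u ∈ S, ∃ k : ℤ, f u = k) : ContinuousOn (fun u ↦ round (f u)) S := by
  refine Int.isClosedEmbedding_coe_real.isInducing.continuousOn_iff.2 (hf.congr fun u hu ↦ ?_)
  obtain ⟨k, hk⟩ := h u hu
  simp [hk]

lemma exists_intCast_of_coe_eq_zero {t : ℝ} (h : (t : UnitAddCircle) = 0) : ∃ k : ℤ, t = k := by
  obtain ⟨k, hk⟩ := (AddCircle.coe_eq_zero_iff (1 : ℝ)).1 h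
  exact ⟨k, by rw [← hk]; simp⟩

end Lifts

/-! ### Refinements over paracompact spaces -/

section Paracompact

variable {M : Type*} [TopologicalSpace M] [T2Space M] [ParacompactSpace M]

/-- Over a paracompact Hausdorff space, a choice of neighbourhoods `N x y u` of the points of
two-fold overlaps is respected by a refinement, provided that the index function may change. -/
lemma PointedCover.exists_refinement (U : PointedCover M) (N : M → M → M → Set M)
    (hN : ∀ x y u, u ∈ U.set x → u ∈ U.set y → N x y u ∈ 𝓝 u) :
    ∃ (τ : M → M) (V : PointedCover M), (∀ u, V.set u ⊆ U.set (τ u)) ∧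
      ∀ u w, (V.set u ∩ V.set w).Nonempty →
        u ∈ U.set (τ u) ∧ u ∈ U.set (τ w) ∧ V.set u ⊆ N (τ u) (τ w) u := by
  obtain ⟨U', hU'o, hU'c, hU'f, hU'U⟩ := precise_refinement U.set U.isOpen_set
    (iUnion_eq_univ_iff.2 fun x ↦ ⟨x, U.mem_set x⟩)
  obtain ⟨F, hFc, hFo, hFU⟩ := exists_iUnion_eq_closure_subset hU'o
    (fun x ↦ hU'f.point_finite x) hU'c
  have hFf : LocallyFinite fun x ↦ closure (F x) := hU'f.subset hFU
  choose τ hτ using fun u ↦ iUnion_eq_univ_iff.1 hFc u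
  have hUτ : ∀ u y, u ∈ closure (F y) → u ∈ U.set y := fun u y h ↦ hU'U y (hFU y h)
  -- `W u` avoids the closed sets that do not contain `u` and lies in `N` for the finitely many
  -- that do
  let W : M → Set M := fun u ↦ F (τ u) ∩ (⋂ (y) (_ : u ∉ closure (F y)), (closure (F y))ᶜ) ∩
    ⋂ y ∈ {y | u ∈ closure (F y)}, N (τ u) y u
  have hW : ∀ u, W u ∈ 𝓝 u := fun u ↦ by
    refine Filter.inter_mem (Filter.inter_mem ((hFo _).mem_nhds (hτ u)) ?_) ?_
    · exact hFf.iInter_compl_mem_nhds (fun _ ↦ isClosed_closure) u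
    · refine (Filter.biInter_mem (hFf.point_finite u)).2 fun y hy ↦ ?_
      exact hN _ _ _ (hUτ _ _ (subset_closure (hτ u))) (hUτ _ _ hy)
  refine ⟨τ, ⟨fun u ↦ interior (W u), fun _ ↦ isOpen_interior,
    fun u ↦ mem_interior_iff_mem_nhds.2 (hW u)⟩, fun u ↦ ?_, fun u w ⟨p, hpu, hpw⟩ ↦ ?_⟩
  · exact fun v hv ↦ hUτ _ _ (subset_closure (interior_subset hv).1.1)
  · -- a point of `V u` in `F (τ w)` forces `u` to lie in the closure of `F (τ w)`
    have hu : u ∈ closure (F (τ w)) := by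
      by_contra h
      exact mem_iInter₂.1 (interior_subset hpu).1.2 _ h (subset_closure (interior_subset hpw).1.1)
    exact ⟨hUτ _ _ (subset_closure (hτ u)), hUτ _ _ hu,
      fun v hv ↦ mem_iInter₂.1 (interior_subset hv).2 _ hu⟩

/-- A circle-valued 1-cochain on a paracompact Hausdorff space lifts to a real-valued 1-cochain
after reindexing to a finer cover. -/
lemma exists_real_lift (U : PointedCover M) (a : RawCochain UnitAddCircle M 1)
    (ha : ∀ x, ContinuousOn (a x) (U.overlap x)) :
    ∃ (τ : M → M) (V : PointedCover M) (b : RawCochain ℝ M 1), (∀ u, V.set u ⊆ U.set (τ u)) ∧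
      (∀ x, ContinuousOn (b x) (V.overlap x)) ∧
      ∀ x, ∀ u ∈ V.overlap x, (b x u : UnitAddCircle) = a (τ ∘ x) u := by
  have hloc : ∀ x y u, ∃ N : Set M, ∃ g : M → ℝ, u ∈ U.set x → u ∈ U.set y → N ∈ 𝓝 u ∧
      ContinuousOn g N ∧ ∀ v ∈ N, (g v : UnitAddCircle) = a ![x, y] v := by
    intro x y u
    by_cases h : u ∈ U.set x ∩ U.set y
    · have hS : U.overlap ![x, y] = U.set x ∩ U.set y := by
        ext v; simp [PointedCover.overlap, Fin.forall_fin_two]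
      obtain ⟨N, hN, g, hg⟩ := exists_local_lift ((U.isOpen_set x).inter (U.isOpen_set y))
        (hS ▸ ha ![x, y]) h
      exact ⟨N, g, fun _ _ ↦ ⟨hN, hg⟩⟩
    · exact ⟨univ, 0, fun h1 h2 ↦ absurd ⟨h1, h2⟩ h⟩
  choose N g hg using hloc
  obtain ⟨τ, V, hV, hVN⟩ := U.exists_refinement N fun x y u hx hy ↦ (hg x y u hx hy).1
  have key : ∀ x : Fin 2 → M, ∀ u ∈ V.overlap x, x 0 ∈ U.set (τ (x 0)) ∧
      x 0 ∈ U.set (τ (x 1)) ∧ V.set (x 0) ⊆ N (τ (x 0)) (τ (x 1)) (x 0) :=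
    fun x u hu ↦ hVN _ _ ⟨u, hu 0, hu 1⟩
  refine ⟨τ, V, fun x u ↦ g (τ (x 0)) (τ (x 1)) (x 0) u, hV, fun x ↦ ?_, fun x u hu ↦ ?_⟩
  · intro u hu
    obtain ⟨h0, h1, h2⟩ := key x u hu
    exact ((hg _ _ _ h0 h1).2.1.mono fun v (hv : v ∈ V.overlap x) ↦ h2 (hv 0)) u hu
  · obtain ⟨h0, h1, h2⟩ := key x u hu
    rw [(hg _ _ _ h0 h1).2.2 u (h2 (hu 0))]
    congr 1
    funext i; fin_cases i <;> rfl

/-- If a real-valued cochain `ζ` is modulo `ℤ` the coboundary of a circle-valued cochain, then the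
class of the integral cocycle `dζ` vanishes. This is the vanishing of the connecting homomorphism
`Ȟ²(M, ℝ/ℤ) → Ȟ³(M, ℤ)` on coboundaries. -/
lemma mem_coboundaries_of_coe_eq_d {n : RawCochain ℤ M 3} (hn : n ∈ cocycles ℤ M 3)
    (W : PointedCover M) {ζ : RawCochain ℝ M 2} (hζ : ∀ x, ContinuousOn (ζ x) (W.overlap x))
    (hnζ : ∀ x, ∀ u ∈ W.overlap x, (n x u : ℝ) = d 2 ζ x u)
    {a : RawCochain UnitAddCircle M 1} (ha : ∀ x, ContinuousOn (a x) (W.overlap x))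
    (haζ : ∀ x, ∀ u ∈ W.overlap x, (ζ x u : UnitAddCircle) = d 1 a x u) :
    n ∈ coboundaries ℤ M 3 := by
  obtain ⟨U, hU, hdn⟩ := exists_cover_of_mem_cocycles hn
  have hWU : ∀ {l : ℕ} (x : Fin (l + 1) → M), (W.inf U).overlap x ⊆ W.overlap x :=
    fun x u hu ↦ (PointedCover.mem_overlap_inf hu).1
  obtain ⟨τ, V, b, hV, hb, hba⟩ := exists_real_lift (W.inf U) a fun x ↦ (ha x).mono (hWU x)
  have hVW : ∀ {l : ℕ} {x : Fin (l + 1) → M} {u}, u ∈ V.overlap x → u ∈ W.overlap (τ ∘ x) :=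
    fun hu ↦ hWU _ fun i ↦ hV _ (hu i)
  have h1 := reindex_sub_mem_coboundaries (W.inf U) V
    (fun x ↦ (hU x).mono fun u hu ↦ (PointedCover.mem_overlap_inf hu).2)
    (fun x u hu ↦ hdn x u (PointedCover.mem_overlap_inf hu).2) τ hV
  -- `r` is integer-valued, and `dr` is the reindexed `dζ` because `ddb = 0`
  let r : RawCochain ℝ M 2 := fun x u ↦ ζ (τ ∘ x) u - d 1 b x u
  have hr : ∀ x, ∀ u ∈ V.overlap x, ∃ k : ℤ, r x u = k := fun x u hu ↦ by
    refine exists_intCast_of_coe_eq_zero ?_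
    have hb' : ∀ i j : Fin 3, (b ![x i, x j] u : UnitAddCircle) = a ![τ (x i), τ (x j)] u := by
      intro i j
      rw [hba _ u (fun l ↦ by fin_cases l <;> exact hu _)]
      congr 1; funext l; fin_cases l <;> rfl
    rw [AddCircle.coe_sub, haζ _ u (hVW hu), d_one_apply, d_one_apply, AddCircle.coe_add,
      AddCircle.coe_sub, hb', hb', hb']
    simp
  have hrc : ∀ x, ContinuousOn (r x) (V.overlap x) := fun x ↦ by
    exact ((hζ _).mono fun u hu ↦ hVW hu).sub (continuousOn_d V hb x)
  have h2 : (fun x u ↦ n (τ ∘ x) u) ∈ coboundaries ℤ M 3 := by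
    refine mem_coboundaries_of_eq_d (b := fun x u ↦ round (r x u))
      ⟨V, fun x ↦ continuousOn_round (hrc x) (hr x)⟩ V fun x u hu ↦ ?_
    have hround : ∀ s : Fin 3 → Fin 4, (round (r (x ∘ s) u) : ℝ) = r (x ∘ s) u := fun s ↦ by
      obtain ⟨k, hk⟩ := hr (x ∘ s) u (V.overlap_subset x s hu)
      simp [hk]
    have hd : d 2 (fun y v ↦ (round (r y v) : ℝ)) x u = d 2 r x u := by
      simp only [d, AddMonoidHom.coe_mk, ZeroHom.coe_mk, hround]
    apply Int.cast_injective (α := ℝ)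
    rw [hnζ _ u (hVW hu), intCast_d, hd, d_two_apply, d_two_apply]
    simp only [r, d_one_apply, Matrix.cons_val]
    have e : ∀ i j k : Fin 4, τ ∘ ![x i, x j, x k] = ![(τ ∘ x) i, (τ ∘ x) j, (τ ∘ x) k] :=
      fun i j k ↦ by funext l; fin_cases l <;> rfl
    rw [e, e, e, e]
    ring
  have := sub_mem h2 h1
  rwa [sub_sub_cancel] at this

end Paracompact

end Cech

/-! ### Uniqueness of the Dixmier–Douady class -/

namespace TorusGerbe

lemma IsPrincipalBundle.exists_localSection {G E B : Type*} [AddCommGroup G] [TopologicalSpace G]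
    [TopologicalSpace E] [TopologicalSpace B] [AddAction G E] {π : E → B}
    (h : IsPrincipalBundle G π) (b : B) :
    ∃ (S : Set B) (s : B → E), IsOpen S ∧ b ∈ S ∧ ContinuousOn s S ∧ ∀ u ∈ S, π (s u) = u := by
  obtain ⟨τ, hb, -⟩ := h.exists_trivialization b
  refine ⟨τ.baseSet, fun u ↦ τ.toOpenPartialHomeomorph.symm (u, 0), τ.open_baseSet, hb, ?_,
    fun u hu ↦ τ.proj_symm_apply' hu⟩
  exact (continuousOn_triv_symm τ).comp (Continuous.continuousOn (by fun_prop))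
    fun u hu ↦ ⟨hu, mem_univ _⟩

namespace BundleGerbe

variable {M : Type*} [TopologicalSpace M] (𝒢 : BundleGerbe M)

lemma mul_vadd_left (s : UnitAddCircle) (p q : 𝒢.P) (h : (𝒢.bdl p).1.2 = (𝒢.bdl q).1.1)
    (h' : (𝒢.bdl (s +ᵥ p)).1.2 = (𝒢.bdl q).1.1) :
    𝒢.mul (s +ᵥ p) q h' = s +ᵥ 𝒢.mul p q h := by
  have key : ∀ q' (hq : q' = q) (h'' : (𝒢.bdl (s +ᵥ p)).1.2 = (𝒢.bdl q').1.1),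
      𝒢.mul (s +ᵥ p) q' h'' = 𝒢.mul (s +ᵥ p) q h' := by rintro _ rfl _; rfl
  have hz : (0 : UnitAddCircle) +ᵥ q = q := zero_vadd _ q
  have := 𝒢.mul_vadd s 0 p q h (by rw [hz]; exact h')
  rwa [key _ hz, add_zero] at this

lemma mul_vadd_right (s : UnitAddCircle) (p q : 𝒢.P) (h : (𝒢.bdl p).1.2 = (𝒢.bdl q).1.1)
    (h' : (𝒢.bdl p).1.2 = (𝒢.bdl (s +ᵥ q)).1.1) :
    𝒢.mul p (s +ᵥ q) h' = s +ᵥ 𝒢.mul p q h := by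
  have key : ∀ p' (hp : p' = p) (h'' : (𝒢.bdl p').1.2 = (𝒢.bdl (s +ᵥ q)).1.1),
      𝒢.mul p' (s +ᵥ q) h'' = 𝒢.mul p (s +ᵥ q) h' := by rintro _ rfl _; rfl
  have hz : (0 : UnitAddCircle) +ᵥ p = p := zero_vadd _ p
  have := 𝒢.mul_vadd 0 s p q h (by rw [hz]; exact h')
  rwa [key _ hz, zero_add] at this

lemma mul_congr {p p' q q' : 𝒢.P} (hp : p = p') (hq : q = q')
    (h : (𝒢.bdl p).1.2 = (𝒢.bdl q).1.1) (h' : (𝒢.bdl p').1.2 = (𝒢.bdl q').1.1) :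
    𝒢.mul p q h = 𝒢.mul p' q' h' := by subst hp hq; rfl

lemma continuousOn_mul {S : Set M} {f g : M → 𝒢.P} (hf : ContinuousOn f S) (hg : ContinuousOn g S)
    (h : ∀ u : S, (𝒢.bdl (f u)).1.2 = (𝒢.bdl (g u)).1.1) :
    Continuous fun u : S ↦ 𝒢.mul (f u) (g u) (h u) :=
  𝒢.continuous_mul.comp (f := fun u : S ↦ (⟨(f u, g u), h u⟩ :
    {r : 𝒢.P × 𝒢.P // (𝒢.bdl r.1).1.2 = (𝒢.bdl r.2).1.1}))
    (Continuous.subtype_mk (hf.domRestrict.prodMk hg.domRestrict) _)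

/-- The difference of the two ways around a square: if `t`, `t'` are elements of `P` over
`(y, y')`, `(w, w')` and `s`, `s'` are elements over `(y, w)`, `(y', w')`, then this is the `a` with
`t · s' = a + s · t'`. It is zero if the points are not of this form. -/
def squareDiff (t s' s t' : 𝒢.P) : UnitAddCircle :=
  open Classical in
  if h : (𝒢.bdl t).1.2 = (𝒢.bdl s').1.1 ∧ (𝒢.bdl s).1.2 = (𝒢.bdl t').1.1 ∧
      (𝒢.bdl s).1.1 = (𝒢.bdl t).1.1 ∧ (𝒢.bdl t').1.2 = (𝒢.bdl s').1.2 then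
    𝒢.isPrincipalBundle.diff (𝒢.mul s t' h.2.1) (𝒢.mul t s' h.1) (Subtype.ext (by
      rw [𝒢.bdl_mul, 𝒢.bdl_mul, h.2.2.1, h.2.2.2]))
  else 0

lemma mul_eq_squareDiff_vadd {t s' s t' : 𝒢.P} (h1 : (𝒢.bdl t).1.2 = (𝒢.bdl s').1.1)
    (h2 : (𝒢.bdl s).1.2 = (𝒢.bdl t').1.1) (h3 : (𝒢.bdl s).1.1 = (𝒢.bdl t).1.1)
    (h4 : (𝒢.bdl t').1.2 = (𝒢.bdl s').1.2) :
    𝒢.mul t s' h1 = 𝒢.squareDiff t s' s t' +ᵥ 𝒢.mul s t' h2 := by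
  rw [squareDiff, dif_pos ⟨h1, h2, h3, h4⟩, IsPrincipalBundle.diff_vadd]

lemma continuousOn_squareDiff {S : Set M} {t s' s t' : M → 𝒢.P} (ht : ContinuousOn t S)
    (hs' : ContinuousOn s' S) (hs : ContinuousOn s S) (ht' : ContinuousOn t' S)
    (h1 : ∀ u ∈ S, (𝒢.bdl (t u)).1.2 = (𝒢.bdl (s' u)).1.1)
    (h2 : ∀ u ∈ S, (𝒢.bdl (s u)).1.2 = (𝒢.bdl (t' u)).1.1)
    (h3 : ∀ u ∈ S, (𝒢.bdl (s u)).1.1 = (𝒢.bdl (t u)).1.1)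
    (h4 : ∀ u ∈ S, (𝒢.bdl (t' u)).1.2 = (𝒢.bdl (s' u)).1.2) :
    ContinuousOn (fun u ↦ 𝒢.squareDiff (t u) (s' u) (s u) (t' u)) S := by
  rw [continuousOn_iff_continuous_domRestrict]
  have c1 := 𝒢.continuousOn_mul ht hs' fun u ↦ h1 u u.2
  have c2 := 𝒢.continuousOn_mul hs ht' fun u ↦ h2 u u.2
  have he : ∀ u : S, 𝒢.bdl (𝒢.mul (s u) (t' u) (h2 u u.2))
      = 𝒢.bdl (𝒢.mul (t u) (s' u) (h1 u u.2)) := fun u ↦ Subtype.ext (by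
    rw [𝒢.bdl_mul, 𝒢.bdl_mul, h3 u u.2, h4 u u.2])
  refine (𝒢.isPrincipalBundle.continuous_diff.comp
    (Continuous.subtype_mk (c2.prodMk c1) he)).congr fun u ↦ ?_
  rw [domRestrict_apply, squareDiff, dif_pos ⟨h1 u u.2, h2 u u.2, h3 u u.2, h4 u u.2⟩]
  rfl

variable {𝒢}

/-- Two choices of sections of `Y` and `P` are related, near each point, by a section `t` of `P`
along the two sections of `Y`. -/
lemma LocalData.exists_connecting_section (D D' : 𝒢.LocalData) (x : M) :
    ∃ (S : Set M) (t : M → 𝒢.P), IsOpen S ∧ x ∈ S ∧ S ⊆ D.U.set x ∩ D'.U.set x ∧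
      ContinuousOn t S ∧ ∀ u ∈ S, (𝒢.bdl (t u)).1 = (D.σ x u, D'.σ x u) := by
  classical
  let O := D.U.set x ∩ D'.U.set x
  have hO : IsOpen O := (D.U.isOpen_set x).inter (D'.U.isOpen_set x)
  have hxO : x ∈ O := ⟨D.U.mem_set x, D'.U.mem_set x⟩
  have hp : ∀ u ∈ O, 𝒢.proj (D.σ x u) = 𝒢.proj (D'.σ x u) := fun u hu ↦
    (D.proj_σ x u hu.1).trans (D'.proj_σ x u hu.2).symm
  let f : M → {y : 𝒢.Y × 𝒢.Y // 𝒢.proj y.1 = 𝒢.proj y.2} := fun u ↦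
    if hu : u ∈ O then ⟨(D.σ x u, D'.σ x u), hp u hu⟩ else ⟨(D.σ x x, D'.σ x x), hp x hxO⟩
  have hf : ∀ u ∈ O, (f u).1 = (D.σ x u, D'.σ x u) := fun u hu ↦ by simp only [f, dif_pos hu]
  have hfc : ContinuousOn f O := by
    refine IsInducing.subtypeVal.continuousOn_iff.2 ?_
    refine (((D.continuousOn_σ x).mono inter_subset_left).prodMk
      ((D'.continuousOn_σ x).mono inter_subset_right)).congr fun u hu ↦ hf u hu
  obtain ⟨S, s, hS, hxS, hs, hsS⟩ := 𝒢.isPrincipalBundle.exists_localSection (f x)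
  refine ⟨O ∩ f ⁻¹' S, s ∘ f, hfc.isOpen_inter_preimage hO hS, ⟨hxO, hxS⟩, inter_subset_left,
    hs.comp (hfc.mono inter_subset_left) fun u hu ↦ hu.2, fun u hu ↦ ?_⟩
  rw [Function.comp, hsS _ hu.2, hf u hu.1]

/-- The Dixmier–Douady class does not depend on the choice of local data. -/
lemma IsDixmierDouadyClass.unique [T2Space M] [ParacompactSpace M] {ξ ξ' : Cech.H ℤ M 3}
    (hξ : 𝒢.IsDixmierDouadyClass ξ) (hξ' : 𝒢.IsDixmierDouadyClass ξ') : ξ = ξ' := by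
  obtain ⟨D, c, hc, hcD, rfl⟩ := hξ
  obtain ⟨D', c', hc', hcD', rfl⟩ := hξ'
  refine Eq.symm (Cech.H.mk_eq_mk_iff.2 ?_)
  choose S t hS hxS hSU ht hbt using D.exists_connecting_section D'
  let W : Cech.PointedCover M := ⟨S, hS, hxS⟩
  have hW : ∀ {k : ℕ} {x : Fin (k + 1) → M} {u}, u ∈ W.overlap x → u ∈ D.U.overlap x :=
    fun hu i ↦ (hSU _ (hu i)).1
  have hW' : ∀ {k : ℕ} {x : Fin (k + 1) → M} {u}, u ∈ W.overlap x → u ∈ D'.U.overlap x :=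
    fun hu i ↦ (hSU _ (hu i)).2
  have hs : ∀ {x y u}, u ∈ S x → u ∈ S y → (𝒢.bdl (D.s x y u)).1 = (D.σ x u, D.σ y u) :=
    fun hx hy ↦ D.bdl_s _ _ _ ⟨(hSU _ hx).1, (hSU _ hy).1⟩
  have hs' : ∀ {x y u}, u ∈ S x → u ∈ S y → (𝒢.bdl (D'.s x y u)).1 = (D'.σ x u, D'.σ y u) :=
    fun hx hy ↦ D'.bdl_s _ _ _ ⟨(hSU _ hx).2, (hSU _ hy).2⟩
  let a : Cech.RawCochain UnitAddCircle M 1 := fun x u ↦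
    𝒢.squareDiff (t (x 0) u) (D'.s (x 0) (x 1) u) (D.s (x 0) (x 1) u) (t (x 1) u)
  have hts' : ∀ {x y u}, u ∈ S x → u ∈ S y → (𝒢.bdl (t x u)).1.2 = (𝒢.bdl (D'.s x y u)).1.1 :=
    fun hx hy ↦ by rw [hbt _ _ hx, hs' hx hy]
  have hst : ∀ {x y u}, u ∈ S x → u ∈ S y → (𝒢.bdl (D.s x y u)).1.2 = (𝒢.bdl (t y u)).1.1 :=
    fun hx hy ↦ by rw [hs hx hy, hbt _ _ hy]
  have ha : ∀ {x y u} (hx : u ∈ S x) (hy : u ∈ S y), 𝒢.mul (t x u) (D'.s x y u) (hts' hx hy)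
      = a ![x, y] u +ᵥ 𝒢.mul (D.s x y u) (t y u) (hst hx hy) := fun hx hy ↦
    𝒢.mul_eq_squareDiff_vadd (hts' hx hy) (hst hx hy) (by rw [hs hx hy, hbt _ _ hx])
      (by rw [hs' hx hy, hbt _ _ hy])
  refine Cech.mem_coboundaries_of_coe_eq_d (sub_mem hc' hc) W (ζ := D'.η - D.η) (a := a)
    (fun x ↦ ((D'.continuousOn_η x).mono fun u hu ↦ hW' hu).sub
      ((D.continuousOn_η x).mono fun u hu ↦ hW hu)) (fun x u hu ↦ ?_) (fun x ↦ ?_)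
    fun x u hu ↦ ?_
  · rw [map_sub]
    simp only [Pi.sub_apply]
    rw [← hcD x u (hW hu), ← hcD' x u (hW' hu)]
    push_cast; rfl
  · refine 𝒢.continuousOn_squareDiff ((ht _).mono fun u hu ↦ hu 0)
      ((D'.continuousOn_s _ _).mono fun u hu ↦ ⟨hW' hu 0, hW' hu 1⟩)
      ((D.continuousOn_s _ _).mono fun u hu ↦ ⟨hW hu 0, hW hu 1⟩) ((ht _).mono fun u hu ↦ hu 1)
      ?_ ?_ ?_ ?_
    · exact fun u hu ↦ hts' (hu 0) (hu 1)
    · exact fun u hu ↦ hst (hu 0) (hu 1)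
    · exact fun u hu ↦ by rw [hs (hu 0) (hu 1), hbt _ _ (hu 0)]
    · exact fun u hu ↦ by rw [hs' (hu 0) (hu 1), hbt _ _ (hu 1)]
  · -- both sides are computed from `t · s' · s'`, bracketed in the two possible ways
    have m0 : u ∈ S (x 0) := hu 0
    have m1 : u ∈ S (x 1) := hu 1
    have m2 : u ∈ S (x 2) := hu 2
    have hc1 : (𝒢.bdl (D.s (x 0) (x 1) u)).1.2 = (𝒢.bdl (D.s (x 1) (x 2) u)).1.1 := by
      rw [hs m0 m1, hs m1 m2]
    have hc2 : (𝒢.bdl (D'.s (x 0) (x 1) u)).1.2 = (𝒢.bdl (D'.s (x 1) (x 2) u)).1.1 := by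
      rw [hs' m0 m1, hs' m1 m2]
    have η1 := D.mul_s x u (hW hu) hc1
    have η2 := D'.mul_s x u (hW' hu) hc2
    have a01 := ha m0 m1
    have a12 := ha m1 m2
    have a02 := ha m0 m2
    have L : 𝒢.mul (t (x 0) u) (𝒢.mul (D'.s (x 0) (x 1) u) (D'.s (x 1) (x 2) u) hc2)
        (by rw [𝒢.bdl_mul]; exact hts' m0 m1)
        = ((D'.η x u : UnitAddCircle) + a ![x 0, x 2] u) +ᵥ
          𝒢.mul (D.s (x 0) (x 2) u) (t (x 2) u) (hst m0 m2) := by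
      rw [𝒢.mul_congr rfl η2 _ (by rw [← η2, 𝒢.bdl_mul]; exact hts' m0 m1),
        𝒢.mul_vadd_right _ _ _ (hts' m0 m2), a02, vadd_vadd]
    have R : 𝒢.mul (𝒢.mul (t (x 0) u) (D'.s (x 0) (x 1) u) (hts' m0 m1)) (D'.s (x 1) (x 2) u)
        (by rw [𝒢.bdl_mul]; exact hc2)
        = (a ![x 0, x 1] u + (a ![x 1, x 2] u + (D.η x u : UnitAddCircle))) +ᵥ
          𝒢.mul (D.s (x 0) (x 2) u) (t (x 2) u) (hst m0 m2) := by
      have e1 : (𝒢.bdl (𝒢.mul (D.s (x 0) (x 1) u) (t (x 1) u) (hst m0 m1))).1.2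
          = (𝒢.bdl (D'.s (x 1) (x 2) u)).1.1 := by rw [𝒢.bdl_mul]; exact hts' m1 m2
      have e2 : (𝒢.bdl (D.s (x 0) (x 1) u)).1.2
          = (𝒢.bdl (𝒢.mul (D.s (x 1) (x 2) u) (t (x 2) u) (hst m1 m2))).1.1 := by
        rw [𝒢.bdl_mul]; exact hc1
      rw [𝒢.mul_congr a01 rfl _ (by rw [← a01, 𝒢.bdl_mul]; exact hc2),
        𝒢.mul_vadd_left _ _ _ e1,
        𝒢.mul_assoc _ _ _ _ (hts' m1 m2) _ (by rw [𝒢.bdl_mul]; exact hst m0 m1),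
        𝒢.mul_congr rfl a12 _ (by rw [← a12, 𝒢.bdl_mul]; exact hst m0 m1),
        𝒢.mul_vadd_right _ _ _ e2,
        ← 𝒢.mul_assoc _ _ _ hc1 _ (by rw [𝒢.bdl_mul]; exact hst m1 m2),
        𝒢.mul_congr η1 rfl _ (by rw [← η1, 𝒢.bdl_mul]; exact hst m1 m2),
        𝒢.mul_vadd_left _ _ _ (hst m0 m2), vadd_vadd, vadd_vadd, add_assoc]
    have := 𝒢.isPrincipalBundle.vadd_right_cancel
      (R.symm.trans ((𝒢.mul_assoc _ _ _ _ _ _ _).trans L))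
    rw [Cech.d_one_apply]
    change ((D'.η x u - D.η x u : ℝ) : UnitAddCircle) = _
    rw [AddCircle.coe_sub, sub_eq_iff_eq_add, ← sub_eq_zero]
    rw [← sub_eq_zero] at this
    rw [← neg_eq_zero, ← this]
    abel

end BundleGerbe

end TorusGerbe

/-! ### The first cohomology of the circle -/

namespace Cech

section Primitive

variable {M : Type*} [TopologicalSpace M] [T2Space M] [ParacompactSpace M]

/-- An integral 1-cocycle on a paracompact Hausdorff space is a coboundary of continuous real-valued
functions: for a subordinate partition of unity `ρ`, take `f_x = ∑ᵢ ρᵢ c_{ix}`. -/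
lemma exists_real_primitive {c : RawCochain ℤ M 1} (hc : c ∈ cocycles ℤ M 1) :
    ∃ (U : PointedCover M) (f : M → M → ℝ), (∀ x, ContinuousOn (c x) (U.overlap x)) ∧
      (∀ x, ContinuousOn (f x) (U.set x)) ∧
      ∀ x y, ∀ u ∈ U.set x ∩ U.set y, (c ![x, y] u : ℝ) = f y u - f x u := by
  obtain ⟨U, hU, hdc⟩ := exists_cover_of_mem_cocycles hc
  obtain ⟨ρ, hρ⟩ := PartitionOfUnity.exists_isSubordinate isClosed_univ U.set U.isOpen_set
    fun x _ ↦ mem_iUnion.2 ⟨x, U.mem_set x⟩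
  have hfin : ∀ u₀, ∃ s : Finset M, ∃ n ∈ 𝓝 u₀, (∀ i ∈ s, n ⊆ U.set i) ∧ ∀ v ∈ n,
      ∀ g : M → ℝ, ∑ᶠ i, ρ i v * g i = ∑ i ∈ s, ρ i v * g i := by
    intro u₀
    obtain ⟨s, n, hn, hnU, hns⟩ := ρ.exists_finset_nhds_support_subset hρ U.isOpen_set u₀
    refine ⟨s, n, hn, fun i hi v hv ↦ mem_iInter₂.1 (hnU hv) i hi, fun v hv g ↦ ?_⟩
    refine finsum_eq_sum_of_support_subset _ fun i hi ↦ hns v hv ?_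
    exact fun h ↦ hi (by simp only [h, zero_mul])
  refine ⟨U, fun y u ↦ ∑ᶠ i, ρ i u * (c ![i, y] u : ℝ), hU, fun y u₀ hu₀ ↦ ?_,
    fun x y u hu ↦ ?_⟩
  · obtain ⟨s, n, hn, hnU, hns⟩ := hfin u₀
    have hcont : ContinuousOn (fun v ↦ ∑ i ∈ s, ρ i v * (c ![i, y] v : ℝ)) (n ∩ U.set y) := by
      refine continuousOn_finsetSum _ fun i hi ↦ (ρ i).continuous.continuousOn.mul ?_
      refine continuous_of_discreteTopology.comp_continuousOn ((hU ![i, y]).mono ?_)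
      intro v hv j
      fin_cases j
      exacts [hnU i hi hv.1, hv.2]
    have hcont' := hcont.congr fun v hv ↦ hns v hv.1 _
    have h1 := hcont' u₀ ⟨mem_of_mem_nhds hn, hu₀⟩
    rwa [inter_comm, continuousWithinAt_inter hn] at h1
  · obtain ⟨s, n, hn, hnU, hns⟩ := hfin u
    have hun := mem_of_mem_nhds hn
    have h1 : ∑ i ∈ s, ρ i u = 1 := by
      have := hns u hun 1
      simp only [Pi.one_apply, mul_one] at this
      rw [← this, ρ.sum_eq_one (mem_univ u)]
    change _ = ∑ᶠ i, ρ i u * (c ![i, y] u : ℝ) - ∑ᶠ i, ρ i u * (c ![i, x] u : ℝ)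
    rw [hns u hun, hns u hun, ← Finset.sum_sub_distrib, ← one_mul (c ![x, y] u : ℝ), ← h1,
      Finset.sum_mul]
    refine Finset.sum_congr rfl fun i hi ↦ ?_
    have := hdc ![i, x, y] u fun j ↦ by
      fin_cases j
      exacts [hnU i hi hun, hu.1, hu.2]
    rw [d_one_apply] at this
    simp only [Matrix.cons_val] at this
    rw [← mul_sub, ← Int.cast_sub]
    congr 2
    linarith

end Primitive

/-! ### The generator -/

lemma exists_circleChart (α : UnitAddCircle) : ∃ e : OpenPartialHomeomorph ℝ UnitAddCircle,
    α ∈ e.target ∧ ∀ t, e t = (t : UnitAddCircle) := by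
  obtain ⟨t, rfl⟩ := QuotientAddGroup.mk_surjective α
  obtain ⟨e, he, hec⟩ := (AddCircle.isLocalHomeomorph_coe (1 : ℝ)) t
  have := e.map_source he
  rw [← congrFun hec t] at this
  exact ⟨e, this, fun s ↦ (congrFun hec s).symm⟩

/-- A real-valued lift of the identity of the circle near `α`; the chosen branch only matters on
`circleCover.set α`. -/
def circleLift (α : UnitAddCircle) : UnitAddCircle → ℝ := (exists_circleChart α).choose.symm

/-- The cover of the circle by the domains of the lifts `circleLift`. -/
def circleCover : PointedCover UnitAddCircle where
  set α := (exists_circleChart α).choose.target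
  isOpen_set α := (exists_circleChart α).choose.open_target
  mem_set α := (exists_circleChart α).choose_spec.1

lemma continuousOn_circleLift (α : UnitAddCircle) :
    ContinuousOn (circleLift α) (circleCover.set α) :=
  (exists_circleChart α).choose.continuousOn_symm

lemma coe_circleLift {α β : UnitAddCircle} (h : β ∈ circleCover.set α) :
    (circleLift α β : UnitAddCircle) = β := by
  rw [← (exists_circleChart α).choose_spec.2]
  exact (exists_circleChart α).choose.right_inv h

/-- The integral cocycle of the differences of the lifts `circleLift`. -/
def circleCocycle : RawCochain ℤ UnitAddCircle 1 :=
  fun x u ↦ round (circleLift (x 1) u - circleLift (x 0) u)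

lemma exists_intCast_circleLift_sub {α α' β : UnitAddCircle} (h : β ∈ circleCover.set α)
    (h' : β ∈ circleCover.set α') : ∃ k : ℤ, circleLift α' β - circleLift α β = k :=
  exists_intCast_of_coe_eq_zero (by
    rw [AddCircle.coe_sub, coe_circleLift h, coe_circleLift h', sub_self])

lemma intCast_circleCocycle {x : Fin 2 → UnitAddCircle} {u : UnitAddCircle}
    (h0 : u ∈ circleCover.set (x 0)) (h1 : u ∈ circleCover.set (x 1)) :
    (circleCocycle x u : ℝ) = circleLift (x 1) u - circleLift (x 0) u := by
  obtain ⟨k, hk⟩ := exists_intCast_circleLift_sub h0 h1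
  simp [circleCocycle, hk]

lemma continuousOn_circleCocycle (x : Fin 2 → UnitAddCircle) :
    ContinuousOn (circleCocycle x) (circleCover.overlap x) :=
  continuousOn_round (((continuousOn_circleLift (x 1)).mono
    fun u (hu : u ∈ circleCover.overlap x) ↦ hu 1).sub
      ((continuousOn_circleLift (x 0)).mono fun u (hu : u ∈ circleCover.overlap x) ↦ hu 0))
    fun _ hu ↦ exists_intCast_circleLift_sub (hu 0) (hu 1)

lemma circleCocycle_mem_cocycles : circleCocycle ∈ cocycles ℤ UnitAddCircle 1 := by
  refine ⟨⟨circleCover, continuousOn_circleCocycle⟩, circleCover, fun x u hu ↦ ?_⟩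
  rw [d_one_apply]
  apply Int.cast_injective (α := ℝ)
  push_cast
  rw [intCast_circleCocycle (hu 1) (hu 2), intCast_circleCocycle (hu 0) (hu 2),
    intCast_circleCocycle (hu 0) (hu 1)]
  simp

/-- The standard generator of `Ȟ¹(ℝ/ℤ, ℤ)`. -/
def circleClass : H ℤ UnitAddCircle 1 := H.mk circleCocycle circleCocycle_mem_cocycles

lemma eq_of_continuous_of_int {f : ℝ → ℝ} (hf : Continuous f) (h : ∀ t, ∃ k : ℤ, f t = k)
    (s t : ℝ) : f s = f t := by
  have hc : Continuous fun u ↦ round (f u) :=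
    continuousOn_univ.1 (continuousOn_round hf.continuousOn fun u _ ↦ h u)
  have hst : round (f s) = round (f t) := PreconnectedSpace.constant inferInstance hc
  obtain ⟨k, hk⟩ := h s
  obtain ⟨l, hl⟩ := h t
  rw [hk, hl, round_intCast, round_intCast] at hst
  rw [hk, hl, hst]

lemma continuous_of_local {M N : Type*} [TopologicalSpace M] [TopologicalSpace N]
    (U : PointedCover M) {f : M → N} {g : M → M → N} (hg : ∀ x, ContinuousOn (g x) (U.set x))
    (h : ∀ x, ∀ u ∈ U.set x, f u = g x u) : Continuous f := by
  refine continuous_iff_continuousAt.2 fun x ↦ ?_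
  exact (((hg x).congr (h x)).continuousAt ((U.isOpen_set x).mem_nhds (U.mem_set x)))

/-- Every class in `Ȟ¹(ℝ/ℤ, ℤ)` is a multiple of the standard generator; the multiple is the degree
of the self-map of the circle that a real-valued primitive of a cocycle defines modulo `ℤ`. -/
lemma exists_eq_zsmul_circleClass (ξ : H ℤ UnitAddCircle 1) : ∃ k : ℤ, ξ = k • circleClass := by
  obtain ⟨c, hc, rfl⟩ := H.exists_mk ξ
  obtain ⟨U, f, hcU, hf, hcf⟩ := exists_real_primitive hc
  have hF : ∀ x, ∀ u ∈ U.set x, (f u u : UnitAddCircle) = (f x u : UnitAddCircle) :=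
    fun x u hu ↦ by
      have := hcf x u u ⟨hu, U.mem_set u⟩
      rw [← sub_eq_zero, ← AddCircle.coe_sub, ← this]
      exact TorusGerbe.coe_intCast _
  let F : C(UnitAddCircle, UnitAddCircle) := ⟨fun u ↦ (f u u : UnitAddCircle),
    continuous_of_local U (fun x ↦ (AddCircle.continuous_mk' (1 : ℝ)).comp_continuousOn (hf x)) hF⟩
  obtain ⟨G, ⟨-, hG⟩, -⟩ := (AddCircle.isCoveringMap_coe (1 : ℝ)).existsUnique_continuousMap_lifts
    (F.comp ⟨fun t : ℝ ↦ (t : UnitAddCircle), AddCircle.continuous_mk' 1⟩) 0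
    (f ((0 : ℝ) : UnitAddCircle) ((0 : ℝ) : UnitAddCircle)) rfl
  have hG : ∀ t : ℝ, (G t : UnitAddCircle) = F t := fun t ↦ congrFun hG t
  have hper : ∀ t : ℝ, ((t + 1 : ℝ) : UnitAddCircle) = t := fun t ↦ by
    rw [AddCircle.coe_add, AddCircle.coe_period, add_zero]
  have hint : ∀ t : ℝ, ∃ k : ℤ, G (t + 1) - G t = k := fun t ↦
    exists_intCast_of_coe_eq_zero (by rw [AddCircle.coe_sub, hG, hG, hper, sub_self])
  obtain ⟨k, hk⟩ := hint 0
  have hGk : ∀ t : ℝ, G (t + 1) = G t + k := fun t ↦ by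
    rw [← hk, ← eq_of_continuous_of_int (f := fun t ↦ G (t + 1) - G t) (by fun_prop) hint t 0]
    ring
  have hp : Function.Periodic (fun t : ℝ ↦ G t - k * t) 1 := fun t ↦ by
    change G (t + 1) - k * (t + 1) = G t - k * t
    rw [hGk]; ring
  let h : UnitAddCircle → ℝ := hp.lift
  have hh : ∀ t : ℝ, h t = G t - k * t := fun t ↦ hp.lift_coe t
  have hhc : Continuous h := by
    refine QuotientAddGroup.isOpenQuotientMap_mk.continuous_comp_iff.1 ?_
    refine (?_ : Continuous fun t : ℝ ↦ G t - k * t).congr fun t ↦ (hh t).symm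
    fun_prop
  have hhF : ∀ u : UnitAddCircle, (h u : UnitAddCircle) = F u - k • u := fun u ↦ by
    obtain ⟨t, rfl⟩ := QuotientAddGroup.mk_surjective u
    change ((h (t : UnitAddCircle) : ℝ) : UnitAddCircle)
      = F (t : UnitAddCircle) - k • (t : UnitAddCircle)
    rw [hh, AddCircle.coe_sub, hG, ← zsmul_eq_mul, AddCircle.coe_zsmul]
  let V := U.inf circleCover
  -- `h` is a lift of `F - k • id`, which has degree zero, so that `b` is integer-valued
  let b : UnitAddCircle → UnitAddCircle → ℝ := fun x u ↦ f x u - k * circleLift x u - h u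
  have hb : ∀ x, ∀ u ∈ V.set x, ∃ m : ℤ, b x u = m := fun x u hu ↦
    exists_intCast_of_coe_eq_zero (by
      rw [AddCircle.coe_sub, AddCircle.coe_sub, hhF, ← zsmul_eq_mul, AddCircle.coe_zsmul,
        coe_circleLift hu.2, ← hF x u hu.1]
      exact sub_self _)
  have hbc : ∀ x, ContinuousOn (b x) (V.set x) := fun x ↦ by
    refine ContinuousOn.sub (ContinuousOn.sub ?_ ?_) hhc.continuousOn
    · exact (hf x).mono inter_subset_left
    · exact continuousOn_const.mul ((continuousOn_circleLift x).mono inter_subset_right)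
  refine ⟨k, ?_⟩
  change H.mk c hc = H.mk (k • circleCocycle) (zsmul_mem circleCocycle_mem_cocycles k)
  refine H.mk_eq_mk_iff.2 (mem_coboundaries_of_eq_d (b := fun x u ↦ round (b (x 0) u)) ⟨V, ?_⟩ V ?_)
  · refine fun x ↦ continuousOn_round ((hbc _).mono fun u hu ↦ hu 0) fun u hu ↦ hb _ u (hu 0)
  · intro x u hu
    obtain ⟨m0, hm0⟩ := hb _ u (hu 0)
    obtain ⟨m1, hm1⟩ := hb _ u (hu 1)
    have e : x = ![x 0, x 1] := by funext i; fin_cases i <;> rfl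
    have h1 := hcf (x 0) (x 1) u ⟨(hu 0).1, (hu 1).1⟩
    rw [← e] at h1
    have h2 := intCast_circleCocycle (hu 0).2 (hu 1).2
    rw [d_zero_apply]
    simp only [Matrix.cons_val_fin_one]
    rw [hm0, hm1, round_intCast, round_intCast]
    apply Int.cast_injective (α := ℝ)
    change ((c x u - k • circleCocycle x u : ℤ) : ℝ) = _
    rw [smul_eq_mul]
    push_cast
    rw [← hm0, ← hm1, h1, h2]
    simp only [b]
    ring

lemma zsmul_circleClass_eq_zero {k : ℤ} (hk : k • circleClass = 0) : k = 0 := by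
  change H.mk (k • circleCocycle) (zsmul_mem circleCocycle_mem_cocycles k) = H.mk 0 (zero_mem _)
    at hk
  rw [H.mk_eq_mk_iff, sub_zero] at hk
  obtain ⟨a, ⟨U, hU⟩, _, ⟨b, ⟨V, hV⟩, rfl⟩, hab⟩ := AddSubgroup.mem_sup.1 hk
  let W := (U.inf V).inf circleCover
  -- a primitive `b` corrects `k` times the local lifts to a global lift `r` of `k • id`
  let r : UnitAddCircle → ℝ := fun u ↦ k * circleLift u u - b ![u] u
  have hr : ∀ x, ∀ u ∈ W.set x, r u = k * circleLift x u - b ![x] u := fun x u hu ↦ by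
    have hu' := W.mem_set u
    have h1 := congrFun (congrFun hab ![x, u]) u
    have h2 := hU ![x, u] u fun i ↦ by
      fin_cases i
      exacts [hu.1.1, hu'.1.1]
    have h3 := intCast_circleCocycle (x := ![x, u]) hu.2 hu'.2
    rw [Pi.add_apply, Pi.add_apply, h2, zero_add, d_zero_apply] at h1
    change _ = k * circleCocycle ![x, u] u at h1
    have h4 := congrArg (Int.cast (R := ℝ)) h1
    push_cast at h4
    rw [h3] at h4
    simp only [Matrix.cons_val] at h4
    simp only [r]
    linarith
  have hrc : Continuous r := by
    refine continuous_of_local W (fun x ↦ ?_) hr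
    refine (continuousOn_const.mul ((continuousOn_circleLift x).mono inter_subset_right)).sub ?_
    refine continuous_of_discreteTopology.comp_continuousOn ((hV ![x]).mono fun u hu i ↦ ?_)
    fin_cases i
    exact hu.1.2
  have hint : ∀ t : ℝ, ∃ m : ℤ, r (t : UnitAddCircle) - k * t = m := fun t ↦
    exists_intCast_of_coe_eq_zero (by
      rw [AddCircle.coe_sub, AddCircle.coe_sub, TorusGerbe.coe_intCast, ← zsmul_eq_mul,
        ← zsmul_eq_mul, AddCircle.coe_zsmul, AddCircle.coe_zsmul,
        coe_circleLift (circleCover.mem_set _), sub_zero, sub_self])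
  have := eq_of_continuous_of_int (f := fun t : ℝ ↦ r (t : UnitAddCircle) - k * t)
    ((hrc.comp (AddCircle.continuous_mk' (1 : ℝ))).sub (by fun_prop)) hint 1 0
  simp only [AddCircle.coe_period] at this
  have h0 : ((0 : ℝ) : UnitAddCircle) = 0 := rfl
  rw [h0] at this
  have hk0 : (k : ℝ) = 0 := by linarith
  exact_mod_cast hk0

/-- The generators of `Ȟ¹(ℝ/ℤ, ℤ)` are the standard one and its negative. -/
lemma eq_circleClass_or_eq_neg {γ : H ℤ UnitAddCircle 1} (hγ : AddSubgroup.zmultiples γ = ⊤) :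
    γ = circleClass ∨ γ = -circleClass := by
  obtain ⟨l, hl⟩ := exists_eq_zsmul_circleClass γ
  obtain ⟨m, hm⟩ := AddSubgroup.mem_zmultiples_iff.1
    (show circleClass ∈ AddSubgroup.zmultiples γ from hγ ▸ AddSubgroup.mem_top _)
  have h1 : (m * l - 1) • circleClass = 0 := by
    rw [sub_smul, mul_smul, ← hl, hm, one_smul, sub_self]
  have h2 := zsmul_circleClass_eq_zero h1
  rcases Int.eq_one_or_neg_one_of_mul_eq_one' (show m * l = 1 by omega) with h | h
  · left; rw [hl, h.2, one_smul]
  · right; rw [hl, h.2, neg_smul, one_smul]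

end Cech

/-! ### The class of a principal bundle and of its extensions -/

namespace TorusGerbe

namespace IsPrincipalBundle

variable {G : Type*} [AddCommGroup G] [TopologicalSpace G] [IsTopologicalAddGroup G]
  {G' : Type*} [AddCommGroup G'] [TopologicalSpace G'] [IsTopologicalAddGroup G']
  {E B : Type*} [TopologicalSpace E] [TopologicalSpace B] [AddAction G E] {π : E → B}

lemma continuousOn_localSection (h : IsPrincipalBundle G π) (b : B) :
    ContinuousOn (h.localSection b) (h.cover.set b) :=
  (continuousOn_triv_symm (h.triv b)).comp (Continuous.continuousOn (by fun_prop))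
    fun _ hu ↦ ⟨hu, mem_univ _⟩

lemma continuousOn_transition (h : IsPrincipalBundle G π) (x : Fin 2 → B) :
    ContinuousOn (h.transition x) (h.cover.overlap x) := by
  refine (continuousOn_triv_snd (h.triv (x 0))).comp
    ((h.continuousOn_localSection (x 1)).mono fun u hu ↦ hu 1) fun u hu ↦ ?_
  rw [mem_preimage, h.proj_localSection (hu 1)]
  exact hu 0

lemma transition_add_transition (h : IsPrincipalBundle G π) {b b' b'' u : B}
    (hb : u ∈ h.cover.set b) (hb' : u ∈ h.cover.set b') (hb'' : u ∈ h.cover.set b'') :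
    h.transition ![b, b'] u + h.transition ![b', b''] u = h.transition ![b, b''] u := by
  have h01 : h.transition ![b, b'] u +ᵥ h.localSection b u = h.localSection b' u :=
    h.transition_vadd ![b, b'] hb hb'
  have h12 : h.transition ![b', b''] u +ᵥ h.localSection b' u = h.localSection b'' u :=
    h.transition_vadd ![b', b''] hb' hb''
  have h02 : h.transition ![b, b''] u +ᵥ h.localSection b u = h.localSection b'' u :=
    h.transition_vadd ![b, b''] hb hb''
  refine h.vadd_right_cancel (e := h.localSection b u) ?_
  rw [add_comm, add_vadd, h01, h12, h02]

/-- The class of a principal bundle may be computed from the transition cocycle of any local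
sections. -/
lemma cls_eq_mk (h : IsPrincipalBundle G π) (U : Cech.PointedCover B) (σ : B → B → E)
    (hσ : ∀ x, ContinuousOn (σ x) (U.set x)) (hπσ : ∀ x, ∀ u ∈ U.set x, π (σ x u) = u)
    (z : Cech.RawCochain G B 1) (hz : z ∈ Cech.cocycles G B 1)
    (hzσ : ∀ x, ∀ u ∈ U.overlap x, z x u +ᵥ σ (x 0) u = σ (x 1) u) :
    h.cls = Cech.H.mk z hz := by
  let V := U.inf h.cover
  let g : B → B → G := fun x u ↦ (h.triv x (σ x u)).2
  have hg : ∀ x, ∀ u ∈ V.set x, g x u +ᵥ h.localSection x u = σ x u := fun x u hu ↦ by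
    have e1 := h.proj_localSection hu.2
    have e2 : π (σ x u) = u := hπσ x u hu.1
    obtain ⟨a, ha⟩ := h.exists_vadd_eq (e1.trans e2.symm)
    have hm : π (h.localSection x u) ∈ (h.triv x).baseSet := e1.symm ▸ hu.2
    have h0 : (h.triv x (h.localSection x u)).2 = 0 := by
      rw [localSection, (h.triv x).apply_symm_apply' hu.2]
    change (h.triv x (σ x u)).2 +ᵥ _ = _
    rw [← ha, h.triv_vadd _ _ _ hm, h0, add_zero]
  refine Cech.H.mk_eq_mk_iff.2 (Cech.mem_coboundaries_of_eq_d (b := fun x u ↦ -g (x 0) u)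
    ⟨V, fun x ↦ ?_⟩ V fun x u hu ↦ ?_)
  · refine ContinuousOn.neg ((continuousOn_triv_snd (h.triv (x 0))).comp
      ((hσ (x 0)).mono fun u hu ↦ (hu 0).1) fun u hu ↦ ?_)
    rw [mem_preimage, hπσ _ _ (hu 0).1]
    exact (hu 0).2
  · have h1 := hzσ x u fun i ↦ (hu i).1
    have h2 := h.transition_vadd x (hu 0).2 (hu 1).2
    rw [← hg _ _ (hu 0), ← hg _ _ (hu 1), ← h2, vadd_vadd, vadd_vadd] at h1
    have h3 := h.vadd_right_cancel h1
    rw [Cech.d_zero_apply]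
    change h.transition x u - z x u = -g (x 1) u - -g (x 0) u
    rw [sub_neg_eq_add, sub_eq_iff_eq_add, add_assoc, add_comm (g (x 0) u), h3]
    abel

lemma comp_transition_mem_cocycles (h : IsPrincipalBundle G π) {φ : G →+ G'}
    (hφ : Continuous φ) : (fun x u ↦ φ (h.transition x u)) ∈ Cech.cocycles G' B 1 := by
  refine ⟨⟨h.cover, fun x ↦ hφ.comp_continuousOn (h.continuousOn_transition x)⟩, h.cover,
    fun x u hu ↦ ?_⟩
  rw [Cech.d_one_apply, ← h.transition_add_transition (hu 0) (hu 1) (hu 2), map_add]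
  abel

lemma cls_extension (h : IsPrincipalBundle G π) {φ : G →+ G'} (hφ : Continuous φ) :
    (Extension.isPrincipalBundle h (φ := fun _ ↦ φ) (hφ.comp continuous_snd)).cls
      = Cech.H.mk _ (h.comp_transition_mem_cocycles hφ) := by
  refine cls_eq_mk _ h.cover (fun x u ↦ Extension.mk h (fun _ ↦ φ) (h.localSection x u) 0)
    (fun x ↦ ?_) (fun x u hu ↦ h.proj_localSection hu) _ _ fun x u hu ↦ ?_
  · exact (Extension.isOpenQuotientMap_mk h (φ := fun _ ↦ φ)
      fun _ ↦ continuous_const).continuous.comp_continuousOn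
        ((h.continuousOn_localSection x).prodMk continuousOn_const)
  · rw [Extension.vadd_mk, ← h.transition_vadd x (hu 0) (hu 1), Extension.mk_vadd]

end IsPrincipalBundle

/-! ### Local data for the bundle gerbe of a principal bundle -/

section LocalData

variable {X : Type*} [TopologicalSpace X] {n : ℕ} {Z : Type*} [TopologicalSpace Z]
  [AddAction (SOZ n) Z] {π : Z → X} (hZ : IsPrincipalBundle (SOZ n) π)

namespace SonGerbe

/-- The cover of `X × 𝕋ⁿ` by products of trivializing sets of `Z` and of arcs. -/
def cover : Cech.PointedCover (X × Torus n) where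
  set x := hZ.cover.set x.1 ×ˢ univ.pi fun i ↦ Cech.circleCover.set (x.2 i)
  isOpen_set x := (hZ.cover.isOpen_set x.1).prod
    (isOpen_set_pi finite_univ fun i _ ↦ Cech.circleCover.isOpen_set (x.2 i))
  mem_set x := ⟨hZ.cover.mem_set x.1, fun i _ ↦ Cech.circleCover.mem_set (x.2 i)⟩

/-- The real-valued lift, near `x`, of the `i`-th coordinate of the torus. -/
def lift (i : Fin n) (x u : X × Torus n) : ℝ := Cech.circleLift (x.2 i) (u.2 i)

/-- The integral difference of the lifts near `x` and near `y` of the `i`-th coordinate. -/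
def winding (i : Fin n) (x y u : X × Torus n) : ℤ :=
  Cech.circleCocycle ![x.2 i, y.2 i] (u.2 i)

variable {hZ}

lemma continuousOn_lift (i : Fin n) (x : X × Torus n) :
    ContinuousOn (lift i x) ((cover hZ).set x) :=
  (Cech.continuousOn_circleLift (x.2 i)).comp (Continuous.continuousOn (by fun_prop))
    fun _ hu ↦ hu.2 i (mem_univ i)

lemma coe_lift (i : Fin n) {x u : X × Torus n} (hu : u ∈ (cover hZ).set x) :
    (lift i x u : UnitAddCircle) = u.2 i :=
  Cech.coe_circleLift (hu.2 i (mem_univ i))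

lemma intCast_winding (i : Fin n) {x y u : X × Torus n} (hx : u ∈ (cover hZ).set x)
    (hy : u ∈ (cover hZ).set y) : (winding i x y u : ℝ) = lift i y u - lift i x u :=
  Cech.intCast_circleCocycle (x := ![x.2 i, y.2 i]) (hx.2 i (mem_univ i)) (hy.2 i (mem_univ i))

lemma continuousOn_winding (i : Fin n) (x y : X × Torus n) :
    ContinuousOn (winding i x y) ((cover hZ).set x ∩ (cover hZ).set y) := by
  refine (Cech.continuousOn_circleCocycle ![x.2 i, y.2 i]).comp
    (f := fun u : X × Torus n ↦ u.2 i) (Continuous.continuousOn (by fun_prop)) fun u hu j ↦ ?_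
  fin_cases j
  exacts [hu.1.2 i (mem_univ i), hu.2.2 i (mem_univ i)]

variable (hZ)

/-- The transition function of `Z`, on `X × 𝕋ⁿ`. -/
def trans (x y u : X × Torus n) : SOZ n := hZ.transition ![x.1, y.1] u.1

lemma continuousOn_trans (x y : X × Torus n) :
    ContinuousOn (trans hZ x y) ((cover hZ).set x ∩ (cover hZ).set y) := by
  refine (hZ.continuousOn_transition ![x.1, y.1]).comp continuous_fst.continuousOn fun u hu j ↦ ?_
  fin_cases j
  exacts [hu.1.1, hu.2.1]

lemma trans_add_trans {x y w u : X × Torus n} (hx : u ∈ (cover hZ).set x)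
    (hy : u ∈ (cover hZ).set y) (hw : u ∈ (cover hZ).set w) :
    trans hZ x y u + trans hZ y w u = trans hZ x w u :=
  hZ.transition_add_transition hx.1 hy.1 hw.1

/-- The pair of the chosen sections of `Z × 𝕋ⁿ` near `x` and near `y`. -/
def sectionPair {x y u : X × Torus n} (hx : u ∈ (cover hZ).set x) (hy : u ∈ (cover hZ).set y) :
    Y2 hZ :=
  ⟨((hZ.localSection x.1 u.1, u.2), (hZ.localSection y.1 u.1, u.2)),
    Prod.ext ((hZ.proj_localSection hx.1).trans (hZ.proj_localSection hy.1).symm) rfl⟩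

lemma B_sectionPair {x y u : X × Torus n} (hx : u ∈ (cover hZ).set x)
    (hy : u ∈ (cover hZ).set y) : B hZ (sectionPair hZ hx hy) = trans hZ x y u :=
  hZ.diff_eq _ (hZ.transition_vadd ![x.1, y.1] hx.1 hy.1)

/-- The section of the Poincaré bundles near `x` that is given by the lifts of the coordinates,
as a frame over the pair of sections near `x` and near `y`. -/
def frame {x y u : X × Torus n} (hx : u ∈ (cover hZ).set x) (hy : u ∈ (cover hZ).set y) :
    Fr hZ :=
  ⟨(sectionPair hZ hx hy, fun k ↦ Poincare.mk (lift k.1.1 x u) (lift k.1.2 x u) 0),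
    fun k ↦ by rw [Poincare.proj_mk, coe_lift _ hx, coe_lift _ hx]; rfl⟩

lemma continuous_frame (x y : X × Torus n) :
    Continuous fun u : ↥((cover hZ).set x ∩ (cover hZ).set y) ↦ frame hZ u.2.1 u.2.2 := by
  have hsec : ∀ b : X × Torus n,
      ContinuousOn (fun u : X × Torus n ↦ hZ.localSection b.1 u.1) ((cover hZ).set b) := fun b ↦
    (hZ.continuousOn_localSection b.1).comp continuous_fst.continuousOn fun u hu ↦ hu.1
  refine Continuous.subtype_mk (Continuous.prodMk (Continuous.subtype_mk (Continuous.prodMk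
    (Continuous.prodMk ?_ ?_) (Continuous.prodMk ?_ ?_)) _) (continuous_pi fun k ↦ ?_)) _
  · exact ((hsec x).mono inter_subset_left).domRestrict
  · exact continuous_snd.comp continuous_subtype_val
  · exact ((hsec y).mono inter_subset_right).domRestrict
  · exact continuous_snd.comp continuous_subtype_val
  · have hl : ∀ i, Continuous fun u : ↥((cover hZ).set x ∩ (cover hZ).set y) ↦ lift i x u.1 :=
      fun i ↦ ((continuousOn_lift (hZ := hZ) i x).mono inter_subset_left).domRestrict
    exact continuous_quotient_mk'.comp ((hl _).prodMk ((hl _).prodMk continuous_const))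

/-- The sections near `x` and near `y` of the Poincaré bundle differ by `-nâ`, where `n` is the
difference of the lifts of the first coordinate and `â` is a lift of the second coordinate. It does
not matter which lift is used; the one near `y` is the one for which the coboundary of the
resulting real cochain is the cup product. -/
lemma frameDiff_frame {x y w u : X × Torus n} (hx : u ∈ (cover hZ).set x)
    (hy : u ∈ (cover hZ).set y) (hw : u ∈ (cover hZ).set w) (k : Pairs n)
    (h : (frame hZ hx hy).1.1.1.2 = (frame hZ hy hw).1.1.1.1) :
    frameDiff hZ (frame hZ hx hy) (frame hZ hy hw) h k
      = ((-(winding k.1.1 x y u * lift k.1.2 y u) : ℝ) : UnitAddCircle) := by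
  refine Poincare.isPrincipalBundle.diff_eq _ ?_
  change _ +ᵥ Poincare.mk (lift k.1.1 x u) (lift k.1.2 x u) 0
    = Poincare.mk (lift k.1.1 y u) (lift k.1.2 y u) 0
  have h1 := intCast_winding k.1.1 hx hy
  have h2 := intCast_winding k.1.2 hx hy
  have h3 : ((-(winding k.1.1 x y u * lift k.1.2 y u) : ℝ) : UnitAddCircle)
      = -((winding k.1.1 x y u * lift k.1.2 x u : ℝ) : UnitAddCircle) := by
    rw [show (-(winding k.1.1 x y u * lift k.1.2 y u) : ℝ)
      = -(winding k.1.1 x y u * lift k.1.2 x u)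
        + ((-(winding k.1.1 x y u * winding k.1.2 x y u) : ℤ) : ℝ) by push_cast; rw [h2]; ring,
      AddCircle.coe_add, coe_intCast, add_zero, AddCircle.coe_neg]
  rw [h3, Poincare.vadd_mk, add_zero, ← Poincare.mk_eq_mk _ _ _ (winding k.1.1 x y u)
    (winding k.1.2 x y u), add_neg_cancel, h1, h2]
  congr 1 <;> ring

/-- The real-valued lift of the contribution of the pair of indices `k` to the circle-valued
cocycle of the bundle gerbe. -/
def etaTerm (k : Pairs n) : Cech.RawCochain ℝ (X × Torus n) 2 := fun x u ↦
  -(entry k.1.1 k.1.2 (trans hZ (x 1) (x 2) u) * (winding k.1.1 (x 0) (x 1) u * lift k.1.2 (x 1) u))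

lemma continuousOn_etaTerm (k : Pairs n) (x : Fin 3 → X × Torus n) :
    ContinuousOn (etaTerm hZ k x) ((cover hZ).overlap x) := by
  refine (ContinuousOn.mul ?_ (ContinuousOn.mul ?_ ?_)).neg
  · exact continuous_of_discreteTopology.comp_continuousOn
      ((continuous_entry _ _).comp_continuousOn
        ((continuousOn_trans hZ (x 1) (x 2)).mono fun u hu ↦ ⟨hu 1, hu 2⟩))
  · exact continuous_of_discreteTopology.comp_continuousOn
      ((continuousOn_winding _ (x 0) (x 1)).mono fun u hu ↦ ⟨hu 0, hu 1⟩)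
  · exact (continuousOn_lift _ (x 1)).mono fun u hu ↦ hu 1

open Classical in
/-- The section of the circle bundle along the sections near `x` and near `y` that is given by
`frame`; its values off the overlap are irrelevant. -/
def bundleSection (x y u : X × Torus n) : P hZ :=
  if h : u ∈ (cover hZ).set x ∧ u ∈ (cover hZ).set y then mk hZ (frame hZ h.1 h.2) 0
  else mk hZ (frame hZ ((cover hZ).mem_set u) ((cover hZ).mem_set u)) 0

lemma bundleSection_eq {x y u : X × Torus n} (hx : u ∈ (cover hZ).set x)
    (hy : u ∈ (cover hZ).set y) : bundleSection hZ x y u = mk hZ (frame hZ hx hy) 0 :=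
  dif_pos ⟨hx, hy⟩

lemma continuousOn_bundleSection (x y : X × Torus n) :
    ContinuousOn (bundleSection hZ x y) ((cover hZ).set x ∩ (cover hZ).set y) := by
  have hmk : Continuous fun p : Fr hZ × UnitAddCircle ↦ mk hZ p.1 p.2 := continuous_quotient_mk'
  rw [continuousOn_iff_continuous_domRestrict]
  exact (hmk.comp ((continuous_frame hZ x y).prodMk (continuous_const (y := 0)))).congr
    fun u ↦ (bundleSection_eq hZ u.2.1 u.2.2).symm

lemma bdl_bundleSection {x y u : X × Torus n} (hx : u ∈ (cover hZ).set x)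
    (hy : u ∈ (cover hZ).set y) : (bdl hZ (bundleSection hZ x y u)).1
      = ((hZ.localSection x.1 u.1, u.2), (hZ.localSection y.1 u.1, u.2)) := by
  rw [bundleSection_eq hZ hx hy]; rfl

lemma mul_bundleSection {x : Fin 3 → X × Torus n} {u : X × Torus n}
    (hu : u ∈ (cover hZ).overlap x) (h : (bdl hZ (bundleSection hZ (x 0) (x 1) u)).1.2
      = (bdl hZ (bundleSection hZ (x 1) (x 2) u)).1.1) :
    mul hZ (bundleSection hZ (x 0) (x 1) u) (bundleSection hZ (x 1) (x 2) u) h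
      = (((∑ k, etaTerm hZ k) x u : ℝ) : UnitAddCircle) +ᵥ bundleSection hZ (x 0) (x 2) u := by
  rw [bundleSection_eq hZ (hu 0) (hu 2)]
  refine ((sonGerbe hZ).mul_congr (bundleSection_eq hZ (hu 0) (hu 1))
    (bundleSection_eq hZ (hu 1) (hu 2)) h rfl).trans ?_
  refine (mul_mk hZ (frame hZ (hu 0) (hu 1)) (frame hZ (hu 1) (hu 2)) 0 0 rfl).trans ?_
  change mk hZ (frame hZ (hu 0) (hu 2)) _ = mk hZ (frame hZ (hu 0) (hu 2)) _
  congr 1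
  rw [add_zero, zero_add, add_zero]
  rw [Finset.sum_apply, Finset.sum_apply]
  refine Eq.trans (Finset.sum_congr rfl fun k _ ↦ ?_) (map_sum
    (QuotientAddGroup.mk' (AddSubgroup.zmultiples (1 : ℝ))) (fun k ↦ etaTerm hZ k x u) _).symm
  refine (congrArg₂ (fun m t ↦ entry k.1.1 k.1.2 m • t) (B_sectionPair hZ (hu 1) (hu 2))
    (frameDiff_frame hZ (hu 0) (hu 1) (hu 2) k rfl)).trans ?_
  rw [← AddCircle.coe_zsmul, zsmul_eq_mul, mul_neg]
  rfl

/-- The local data given by the chosen sections of `Z` and the lifts of the coordinates. -/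
def localData : (sonGerbe hZ).LocalData where
  U := cover hZ
  σ x u := (hZ.localSection x.1 u.1, u.2)
  continuousOn_σ x := ((hZ.continuousOn_localSection x.1).comp continuous_fst.continuousOn
    fun _ hu ↦ hu.1).prodMk continuous_snd.continuousOn
  proj_σ x u hu := Prod.ext (hZ.proj_localSection hu.1) rfl
  s := bundleSection hZ
  continuousOn_s := continuousOn_bundleSection hZ
  bdl_s x y u hu := bdl_bundleSection hZ hu.1 hu.2
  η := ∑ k, etaTerm hZ k
  continuousOn_η x := by
    have : (∑ k, etaTerm hZ k) x = fun u ↦ ∑ k, etaTerm hZ k x u := by ext u; simp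
    rw [this]
    exact continuousOn_finsetSum _ fun k _ ↦ continuousOn_etaTerm hZ k x
  mul_s x u hu h := mul_bundleSection hZ hu h

/-- The integral cochain `pr_i^* n ∪ pr_j^* n ∪ pr_X^* z_{ij}`, where `n` is the cocycle of the
circle, `z` is the transition cocycle of `Z`, and `(i, j)` is the pair of indices `k`. -/
def cupTerm (k : Pairs n) : Cech.RawCochain ℤ (X × Torus n) 3 :=
  Cech.rawCup rfl (Cech.rawCup rfl
    (Cech.rawPullback ℤ (fun y : X × Torus n ↦ y.2 k.1.1) 1 Cech.circleCocycle)
    (Cech.rawPullback ℤ (fun y : X × Torus n ↦ y.2 k.1.2) 1 Cech.circleCocycle))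
    (Cech.rawPullback ℤ (fun y : X × Torus n ↦ y.1) 1
      fun x u ↦ entry k.1.1 k.1.2 (hZ.transition x u))

lemma cupTerm_apply (k : Pairs n) (x : Fin 4 → X × Torus n) (u : X × Torus n) :
    cupTerm hZ k x u = winding k.1.1 (x 0) (x 1) u * winding k.1.2 (x 1) (x 2) u
      * entry k.1.1 k.1.2 (trans hZ (x 2) (x 3) u) := by
  simp only [cupTerm, Cech.rawCup, Cech.rawPullback, AddMonoidHom.coe_mk, ZeroHom.coe_mk, winding,
    trans]
  congr 3
  · funext i; fin_cases i <;> rfl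
  · funext i; fin_cases i <;> rfl

/-- The identity behind the formula for the Dixmier–Douady class: with the lifts `L` of the
coordinates, `n_{xy} = L_y - L_x`, and the transition functions `z`, the cochain
`-n^i_{01} L^j_1 z_{12}` has coboundary `n^i_{01} n^j_{12} z_{23}`. -/
lemma intCast_cupTerm (k : Pairs n) {x : Fin 4 → X × Torus n} {u : X × Torus n}
    (hu : u ∈ (cover hZ).overlap x) : (cupTerm hZ k x u : ℝ) = Cech.d 2 (etaTerm hZ k) x u := by
  have hz : ((entry k.1.1 k.1.2 (trans hZ (x 1) (x 3) u) : ℤ) : ℝ)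
      = entry k.1.1 k.1.2 (trans hZ (x 1) (x 2) u)
        + entry k.1.1 k.1.2 (trans hZ (x 2) (x 3) u) := by
    rw [← trans_add_trans hZ (hu 1) (hu 2) (hu 3), map_add, Int.cast_add]
  rw [Cech.d_two_apply, cupTerm_apply]
  simp only [etaTerm, Matrix.cons_val]
  push_cast
  rw [hz, intCast_winding _ (hu 0) (hu 1), intCast_winding _ (hu 1) (hu 2),
    intCast_winding _ (hu 1) (hu 2), intCast_winding _ (hu 0) (hu 2)]
  ring

lemma cupTerm_mem_cocycles (k : Pairs n) : cupTerm hZ k ∈ Cech.cocycles ℤ (X × Torus n) 3 :=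
  Cech.rawCup_mem_cocycles rfl (Cech.rawCup_mem_cocycles rfl
    (Cech.rawPullback_mem_cocycles ⟨fun y : X × Torus n ↦ y.2 k.1.1, by fun_prop⟩
      Cech.circleCocycle_mem_cocycles)
    (Cech.rawPullback_mem_cocycles ⟨fun y : X × Torus n ↦ y.2 k.1.2, by fun_prop⟩
      Cech.circleCocycle_mem_cocycles))
    (Cech.rawPullback_mem_cocycles ⟨fun y : X × Torus n ↦ y.1, by fun_prop⟩
      (hZ.comp_transition_mem_cocycles (continuous_entry k.1.1 k.1.2)))

lemma mk_cupTerm (k : Pairs n) : Cech.H.mk (cupTerm hZ k) (cupTerm_mem_cocycles hZ k)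
    = Cech.cup
      (Cech.cup
        (Cech.pullback ⟨fun y : X × Torus n ↦ y.2 k.1.1, by fun_prop⟩ Cech.circleClass)
        (Cech.pullback ⟨fun y : X × Torus n ↦ y.2 k.1.2, by fun_prop⟩ Cech.circleClass))
      (Cech.pullback ⟨fun y : X × Torus n ↦ y.1, by fun_prop⟩
        (componentClass hZ k.1.1 k.1.2)) := by
  rw [componentClass, hZ.cls_extension (continuous_entry k.1.1 k.1.2)]
  rfl

end SonGerbe

/-- The sum of the cup products is a Dixmier–Douady class, for the standard generator. -/
lemma isDixmierDouadyClass_sonGerbe : (sonGerbe hZ).IsDixmierDouadyClass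
    (∑ k : Pairs n, Cech.cup
      (Cech.cup
        (Cech.pullback ⟨fun y : X × Torus n ↦ y.2 k.1.1, by fun_prop⟩ Cech.circleClass)
        (Cech.pullback ⟨fun y : X × Torus n ↦ y.2 k.1.2, by fun_prop⟩ Cech.circleClass))
      (Cech.pullback ⟨fun y : X × Torus n ↦ y.1, by fun_prop⟩
        (componentClass hZ k.1.1 k.1.2))) := by
  refine ⟨SonGerbe.localData hZ, ∑ k, SonGerbe.cupTerm hZ k,
    sum_mem fun k _ ↦ SonGerbe.cupTerm_mem_cocycles hZ k, fun x u hu ↦ ?_, ?_⟩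
  · change _ = Cech.d 2 (∑ k, SonGerbe.etaTerm hZ k) x u
    rw [map_sum]
    simp only [Finset.sum_apply, Int.cast_sum]
    exact Finset.sum_congr rfl fun k _ ↦ SonGerbe.intCast_cupTerm hZ k hu
  · rw [Cech.H.mk_sum (SonGerbe.cupTerm_mem_cocycles hZ)]
    exact Finset.sum_congr rfl fun k _ ↦ SonGerbe.mk_cupTerm hZ k

end LocalData

end TorusGerbe

/-! ### Pullback to zero-dimensional CW complexes -/

namespace Cech

variable {A : Type*} [AddCommGroup A] [TopologicalSpace A] [IsTopologicalAddGroup A]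

lemma eq_zero_of_discreteTopology {C : Type*} [TopologicalSpace C] [DiscreteTopology C]
    (ξ : H A C 1) : ξ = 0 := by
  obtain ⟨c, hc, rfl⟩ := H.exists_mk ξ
  refine (H.mk_eq_mk_iff (hc' := zero_mem _)).2 ?_
  obtain ⟨U, -, hU⟩ := exists_cover_of_mem_cocycles hc
  refine nullCochains_le_coboundaries
    ⟨⟨fun x ↦ {x}, fun _ ↦ isOpen_discrete _, fun _ ↦ rfl⟩, fun x u hu ↦ ?_⟩
  -- on an overlap of singletons, the cocycle condition for `(u, u, u)` is `c(u, u) = 0`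
  have h := hU ![u, u, u] u fun i ↦ by fin_cases i <;> exact U.mem_set u
  have hx : x = ![u, u] := by
    funext i; fin_cases i
    exacts [(hu 0).symm, (hu 1).symm]
  rw [d_one_apply] at h
  simp only [Matrix.cons_val, sub_self, zero_add] at h
  rw [sub_zero, hx, h]

variable {L M N : Type*} [TopologicalSpace L] [TopologicalSpace M] [TopologicalSpace N] {k l : ℕ}

lemma pullback_pullback (g : C(L, N)) (f : C(N, M)) (ξ : H A M k) :
    pullback g (pullback f ξ) = pullback (f.comp g) ξ := by
  obtain ⟨c, hc, rfl⟩ := H.exists_mk ξ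
  rfl

lemma pullback_cup {R : Type*} [CommRing R] [TopologicalSpace R] [IsTopologicalRing R]
    (f : C(N, M)) (ξ : H R M k) (ζ : H R M l) :
    pullback f (cup ξ ζ) = cup (pullback f ξ) (pullback f ζ) := by
  obtain ⟨a, ha, rfl⟩ := H.exists_mk ξ
  obtain ⟨b, hb, rfl⟩ := H.exists_mk ζ
  rfl

end Cech

namespace TorusGerbe

lemma discreteTopology_of_cwComplex {C : Type*} [TopologicalSpace C] [T2Space C]
    [CWComplex (univ : Set C)]
    (h : ∀ m, 1 ≤ m → IsEmpty (RelCWComplex.cell (univ : Set C) m)) : DiscreteTopology C := by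
  refine discreteTopology_iff_forall_isClosed.2 fun S ↦ ?_
  refine (CWComplex.closed (univ : Set C) S (subset_univ S)).2 fun m j ↦ ?_
  rcases Nat.eq_zero_or_pos m with rfl | hm
  · rw [RelCWComplex.closedCell_zero_eq_singleton]
    exact (Set.finite_singleton _).subset inter_subset_right |>.isClosed
  · exact ((h m hm).false j).elim

lemma cup_pullback_mem_filtration {E X : Type*} [TopologicalSpace E] [TopologicalSpace X]
    (π : C(E, X)) {k : ℕ} (ζ : Cech.H ℤ E k) (ξ : Cech.H ℤ X 1) :
    Cech.cup ζ (Cech.pullback π ξ) ∈ filtration π 1 (k + 1) := by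
  intro C _ _ _ hC f
  have := discreteTopology_of_cwComplex hC
  let p : C({p : C × E // f p.1 = π p.2}, C) := ⟨fun p ↦ p.1.1, by fun_prop⟩
  have he : π.comp (⟨fun p : {p : C × E // f p.1 = π p.2} ↦ p.1.2, by fun_prop⟩ :
      C({p : C × E // f p.1 = π p.2}, E)) = f.comp p := ContinuousMap.ext fun p ↦ p.2.symm
  rw [Cech.pullback_cup, Cech.pullback_pullback, he, ← Cech.pullback_pullback,
    Cech.eq_zero_of_discreteTopology (Cech.pullback f ξ), map_zero, map_zero]

lemma sum_pairs {A : Type*} [AddCommMonoid A] {n : ℕ} (f : Fin n → Fin n → A) :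
    ∑ k : Pairs n, f k.1.1 k.1.2 = ∑ p : Fin n, ∑ q : Fin n with q < p, f p q := by
  simp only [Finset.sum_filter]
  rw [← Fintype.sum_prod_type' (f := fun p q ↦ if q < p then f p q else 0), ← Finset.sum_filter]
  exact (Finset.sum_subtype _ (by simp) fun k : Fin n × Fin n ↦ f k.1 k.2).symm

end TorusGerbe

end

theorem mainTheorem12 {X : Type*} [TopologicalSpace X] [T2Space X] [ParacompactSpace X]
    (n : ℕ) {Z : Type*} [TopologicalSpace Z] [AddAction (TorusGerbe.SOZ n) Z] {π : Z → X}
    (hZ : TorusGerbe.IsPrincipalBundle (TorusGerbe.SOZ n) π)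
    (γ : Cech.H ℤ UnitAddCircle 1) (hγ : AddSubgroup.zmultiples γ = ⊤) :
    (∀ ξ : Cech.H ℤ (X × TorusGerbe.Torus n) 3,
      (TorusGerbe.sonGerbe hZ).IsDixmierDouadyClass ξ ↔
        ξ = ∑ p : Fin n, ∑ q : Fin n with q < p,
          Cech.cup
            (Cech.cup
              (Cech.pullback ⟨fun y : X × TorusGerbe.Torus n ↦ y.2 p, by fun_prop⟩ γ)
              (Cech.pullback ⟨fun y : X × TorusGerbe.Torus n ↦ y.2 q, by fun_prop⟩ γ))
            (Cech.pullback ⟨fun y : X × TorusGerbe.Torus n ↦ y.1, by fun_prop⟩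
              (TorusGerbe.componentClass hZ p q))) ∧
    ∀ ξ : Cech.H ℤ (X × TorusGerbe.Torus n) 3, (TorusGerbe.sonGerbe hZ).IsDixmierDouadyClass ξ →
      ξ ∈ TorusGerbe.filtration
        (⟨fun y : X × TorusGerbe.Torus n ↦ y.1, by fun_prop⟩ : C(X × TorusGerbe.Torus n, X)) 1 3 := by
  have hDD := TorusGerbe.isDixmierDouadyClass_sonGerbe hZ
  refine ⟨fun ξ ↦ ?_, fun ξ hξ ↦ ?_⟩
  · rw [← TorusGerbe.sum_pairs fun p q ↦ Cech.cup
      (Cech.cup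
        (Cech.pullback ⟨fun y : X × TorusGerbe.Torus n ↦ y.2 p, by fun_prop⟩ γ)
        (Cech.pullback ⟨fun y : X × TorusGerbe.Torus n ↦ y.2 q, by fun_prop⟩ γ))
      (Cech.pullback ⟨fun y : X × TorusGerbe.Torus n ↦ y.1, by fun_prop⟩
        (TorusGerbe.componentClass hZ p q))]
    -- the two factors `γ` absorb the sign of the generator
    have hsign : ∀ f g : C(X × TorusGerbe.Torus n, UnitAddCircle),
        Cech.cup (Cech.pullback f γ) (Cech.pullback g γ)
          = Cech.cup (Cech.pullback f Cech.circleClass) (Cech.pullback g Cech.circleClass) := by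
      intro f g
      rcases Cech.eq_circleClass_or_eq_neg hγ with rfl | rfl
      · rfl
      · rw [map_neg, map_neg, map_neg, map_neg, AddMonoidHom.neg_apply, neg_neg]
    simp only [hsign]
    exact ⟨fun hξ ↦ hξ.unique hDD, fun hξ ↦ hξ ▸ hDD⟩
  · rw [hξ.unique hDD]
    exact sum_mem fun k _ ↦ TorusGerbe.cup_pullback_mem_filtration
      ⟨fun y : X × TorusGerbe.Torus n ↦ y.1, by fun_prop⟩ _ _
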